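/- Let $\Omega=\mathbb{R}^{\mathbb{N}}$ with the product topology and its Borel $\sigma$-algebra, with coordinate variables $\xi_k(\omega)=\omega(k)$, $k\ge 1$, and let $\bar\xi_n=\frac{1}{n}(\xi_1+\cdots+\xi_n)$. Let $\mathbb{E}$ be a sublinear expectation on $C_b(\Omega)$, i.e. a monotone, constant-preserving, subadditive and positively homogeneous functional $C_b(\Omega)\to\mathbb{R}$, and suppose that it is regular: $\mathbb{E}[X_n]\downarrow 0$ whenever $X_n\in C_b(\Omega)$ and $X_n\downarrow 0$ pointwise. Let $\Theta$ be the set of all Borel probability measures $P$ on $\Omega$ with $E_P[X]\le\mathbb{E}[X]$ for all $X\in C_b(\Omega)$. For $p\ge1$ let $L^p_{\mathbb{E}}(\Omega)$ be the completion of $C_b(\Omega)$ under the norm $\|X\|_p=\sup_{P\in\Theta}(E_P[|X|^p])^{1/p}$, to which $\mathbb{E}$ extends by $\mathbb{E}[X]=\sup_{P\in\Theta}E_P[X]$. Assume that $\xi_k\in L^\gamma_{\mathbb{E}}(\Omega)$ for all $k\ge1$, for some $\gamma>1$, and that $(\xi_k)_{k\ge1}$ is i.i.d. under $\mathbb{E}$: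 for every $k\ge1$, $$\mathbb{E}[\varphi(\xi_1,\dots,\xi_k,\xi_{k+1})]=\mathbb{E}\big[\mathbb{E}[\varphi(y_1,\dots,y_k,\xi_{k+1})]\big|_{y_i=\xi_i,\ 1\le i\le k}\big]\quad\text{and}\quad \mathbb{E}[\psi(\xi_{k+1})]=\mathbb{E}[\psi(\xi_k)]$$ for all bounded Lipschitz functions $\varphi:\mathbb{R}^{k+1}\to\mathbb{R}$ and $\psi:\mathbb{R}\to\mathbb{R}$. Put $\overline\mu=\mathbb{E}[\xi_1]$ and $\underline\mu=-\mathbb{E}[-\xi_1]$. Let $\Theta_0$ be a weakly compact set of Borel probability measures on $\Omega$ with $\mathbb{E}[X]=\sup_{P\in\Theta_0}E_P[X]$ for all $X\in C_b(\Omega)$. Then for every $d\in\mathbb{N}$ and every random variable $\Pi=\pi(\xi_1,\dots,\xi_d)$ with $\pi:\mathbb{R}^d\to[\underline\mu,\overline\mu]$ Borel measurable, there exists $P^\Pi\in\Theta_0$ such that $$\lim_{n\to\infty}\bar\xi_n=\Pi\qquad P^\Pi\text{-almost surely}.$$ -/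

import Mathlib

open MeasureTheory Filter Topology

/-- A sublinear expectation on `C_b(Ω)`: a monotone, constant preserving, subadditive and
positively homogeneous real functional on the bounded continuous functions. -/
structure SublinearExpectation (Ω : Type*) [TopologicalSpace Ω] where
  toFun : BoundedContinuousFunction Ω ℝ → ℝ
  mono' : ∀ X Y : BoundedContinuousFunction Ω ℝ, X ≤ Y → toFun X ≤ toFun Y
  const' : ∀ c : ℝ, toFun (BoundedContinuousFunction.const Ω c) = c
  add_le' : ∀ X Y : BoundedContinuousFunction Ω ℝ, toFun (X + Y) ≤ toFun X + toFun Y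
  smul' : ∀ (c : ℝ) (X : BoundedContinuousFunction Ω ℝ), 0 ≤ c → toFun (c • X) = c * toFun X

namespace SublinearExpectation

instance {Ω : Type*} [TopologicalSpace Ω] :
    CoeFun (SublinearExpectation Ω) (fun _ => BoundedContinuousFunction Ω ℝ → ℝ) :=
  ⟨SublinearExpectation.toFun⟩

/-- Regularity: `X n ↓ 0` pointwise on `Ω` implies `𝔼[X n] ↓ 0`
(that `𝔼[X n]` is decreasing is automatic from monotonicity). -/
def IsRegular {Ω : Type*} [TopologicalSpace Ω] (E : SublinearExpectation Ω) : Prop :=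
  ∀ X : ℕ → BoundedContinuousFunction Ω ℝ, Antitone X →
    (∀ ω, Tendsto (fun n => X n ω) atTop (𝓝 0)) → Tendsto (fun n => E (X n)) atTop (𝓝 0)

section

variable {Ω : Type*} [TopologicalSpace Ω] [MeasurableSpace Ω]

/-- The set `Θ₀` of probabilities represents `𝔼`: `𝔼[X] = sup_{P ∈ Θ₀} E_P[X]` on `C_b(Ω)`. -/
def IsRepresentedBy (E : SublinearExpectation Ω) (Θ₀ : Set (ProbabilityMeasure Ω)) : Prop :=
  ∀ X : BoundedContinuousFunction Ω ℝ,
    IsLUB ((fun P : ProbabilityMeasure Ω => ∫ ω, X ω ∂(P : Measure Ω)) '' Θ₀) (E X)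

/-- The maximal set `Θ` of probabilities dominated by `𝔼` on `C_b(Ω)`. -/
def maximalSet (E : SublinearExpectation Ω) : Set (ProbabilityMeasure Ω) :=
  {P | ∀ X : BoundedContinuousFunction Ω ℝ, ∫ ω, X ω ∂(P : Measure Ω) ≤ E X}

/-- `𝔼[X] = sup_{P ∈ Θ} E_P[X]`, the extension of `𝔼` to random variables that need not be
bounded or continuous. It is used for bounded continuous functions and elements of
`L^p_𝔼(Ω)`, `p ≥ 1`, only. -/
noncomputable def expect (E : SublinearExpectation Ω) (X : Ω → ℝ) : ℝ :=
  ⨆ P : E.maximalSet, ∫ ω, X ω ∂((P : ProbabilityMeasure Ω) : Measure Ω)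

/-- `‖X‖_p = (𝔼[|X|^p])^{1/p} = sup_{P ∈ Θ} (E_P[|X|^p])^{1/p}`, with values in `[0, ∞]`. -/
noncomputable def normLp (E : SublinearExpectation Ω) (p : ℝ) (X : Ω → ℝ) : ENNReal :=
  ⨆ P ∈ E.maximalSet, eLpNorm X (ENNReal.ofReal p) ((P : ProbabilityMeasure Ω) : Measure Ω)

/-- `X ∈ L^p_𝔼(Ω)`: the random variable `X` is in the `‖·‖_p`-completion of `C_b(Ω)`, that is,
it is a `‖·‖_p`-limit of bounded continuous functions. -/
def MemLp (E : SublinearExpectation Ω) (p : ℝ) (X : Ω → ℝ) : Prop :=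
  Measurable X ∧ ∀ ε : ENNReal, 0 < ε →
    ∃ φ : BoundedContinuousFunction Ω ℝ, E.normLp p (fun ω => X ω - φ ω) < ε

/-- The random vector `X` is independent of the random vector `Y` under `𝔼`
(not a symmetric relation): the test functions are bounded and Lipschitz. -/
def IsIndepOf (E : SublinearExpectation Ω) {m n : ℕ}
    (X : Ω → Fin m → ℝ) (Y : Ω → Fin n → ℝ) : Prop :=
  ∀ φ : (Fin n → ℝ) × (Fin m → ℝ) → ℝ,
    (∃ C, ∀ z, |φ z| ≤ C) → (∃ K, LipschitzWith K φ) →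
      E.expect (fun ω => φ (Y ω, X ω)) = E.expect (fun ω => E.expect (fun ω' => φ (Y ω, X ω')))

/-- The random variables `X` and `Y` are identically distributed under `𝔼`. -/
def IsIdentDistrib (E : SublinearExpectation Ω) (X Y : Ω → ℝ) : Prop :=
  ∀ φ : ℝ → ℝ, (∃ C, ∀ z, |φ z| ≤ C) → (∃ K, LipschitzWith K φ) →
    E.expect (fun ω => φ (X ω)) = E.expect (fun ω => φ (Y ω))

/-- The sequence `ξ 0, ξ 1, …` is i.i.d. under `𝔼`: each `ξ n` is independent of
`(ξ 0, …, ξ (n - 1))`, and consecutive terms are identically distributed. -/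
def IsIID (E : SublinearExpectation Ω) (ξ : ℕ → Ω → ℝ) : Prop :=
  (∀ n : ℕ, E.IsIndepOf (fun ω (_ : Fin 1) => ξ n ω) (fun ω (i : Fin n) => ξ i ω)) ∧
    ∀ n : ℕ, E.IsIdentDistrib (ξ (n + 1)) (ξ n)

end

end SublinearExpectation

/-! The averages are steered. Suppose that under some measure each coordinate, given the past, has
the largest possible conditional mean while the partial sum is below its target and the smallest
possible one while it is above. A martingale strong law removes the noise, and a deterministic
argument (`tendsto_average_of_drift`) then drives the averages to the target. Since only a moment of
order `γ > 1` is available, coordinate `n` is truncated at `n + 1`: the means of the truncations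
converge to the true ones, and Borel–Cantelli makes the truncation eventually invisible.

The difficulty is to find such a measure inside `Θ₀`, which need not be convex or stable under
pasting of conditional laws. Extremality is therefore expressed by integrals. The variable `centered
s χ n` has nonpositive integral under every dominated measure, and a nonnegative one forces the
extremal conditional means prescribed by the sign of `s`. Independence shows that adding such terms
leaves upper expectations unchanged (`expect_add_centered`), so compactness yields a measure under
which all of them integrate to zero.

The target `π` is merely Borel, while `s` must be Lipschitz. Lipschitz approximations of `π`
converge only almost everywhere, for a law of the first `d` coordinates that must be known before
the perturbations are chosen. `exists_face` resolves this circularity: by Zorn's lemma it produces a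
compact part of `Θ₀` on which that law is constant, but which is still large enough for the
selection. `exists_steered` combines the two. -/

/-! ### Bounded Lipschitz functions and cylinder functions -/

/-- Bounded Lipschitz real functions. -/
def IsBddLip {α : Type*} [PseudoMetricSpace α] (f : α → ℝ) : Prop :=
  (∃ C, ∀ z, |f z| ≤ C) ∧ ∃ K, LipschitzWith K f

namespace IsBddLip

variable {α β : Type*} [PseudoMetricSpace α] [PseudoMetricSpace β] {f g : α → ℝ}

theorem const (c : ℝ) : IsBddLip (fun _ : α => c) :=
  ⟨⟨|c|, fun _ => le_rfl⟩, 0, LipschitzWith.const c⟩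

theorem add (hf : IsBddLip f) (hg : IsBddLip g) : IsBddLip (fun x => f x + g x) := by
  obtain ⟨⟨C, hC⟩, K, hK⟩ := hf
  obtain ⟨⟨D, hD⟩, L, hL⟩ := hg
  exact ⟨⟨C + D, fun z => (abs_add_le _ _).trans (add_le_add (hC z) (hD z))⟩, K + L, hK.add hL⟩

theorem neg (hf : IsBddLip f) : IsBddLip (fun x => - f x) := by
  obtain ⟨⟨C, hC⟩, K, hK⟩ := hf
  exact ⟨⟨C, fun z => by rw [abs_neg]; exact hC z⟩, K, hK.neg⟩

theorem sub (hf : IsBddLip f) (hg : IsBddLip g) : IsBddLip (fun x => f x - g x) := by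
  simpa only [sub_eq_add_neg] using hf.add hg.neg

theorem mul (hf : IsBddLip f) (hg : IsBddLip g) : IsBddLip (fun x => f x * g x) := by
  obtain ⟨⟨C, hC⟩, K, hK⟩ := hf
  obtain ⟨⟨D, hD⟩, L, hL⟩ := hg
  refine ⟨⟨C * D, fun z => ?_⟩, (C.toNNReal * L + D.toNNReal * K), ?_⟩
  · rw [abs_mul]
    exact mul_le_mul (hC z) (hD z) (abs_nonneg _) ((abs_nonneg _).trans (hC z))
  · refine LipschitzWith.of_dist_le_mul fun x y => ?_
    have hC0 : 0 ≤ C := (abs_nonneg _).trans (hC x)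
    have hD0 : 0 ≤ D := (abs_nonneg _).trans (hD x)
    have h1 := hK.dist_le_mul x y
    have h2 := hL.dist_le_mul x y
    rw [Real.dist_eq] at h1 h2 ⊢
    push_cast
    rw [Real.coe_toNNReal _ hC0, Real.coe_toNNReal _ hD0]
    calc |f x * g x - f y * g y| = |f x * (g x - g y) + g y * (f x - f y)| := by ring_nf
      _ ≤ |f x| * |g x - g y| + |g y| * |f x - f y| := by
        rw [← abs_mul, ← abs_mul]; exact abs_add_le _ _
      _ ≤ C * (L * dist x y) + D * (K * dist x y) := by
        gcongr
        · exact hC x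
        · exact hD y
      _ = _ := by ring

theorem comp (hf : IsBddLip f) {u : β → α} {K : NNReal} (hu : LipschitzWith K u) :
    IsBddLip (fun x => f (u x)) := by
  obtain ⟨⟨C, hC⟩, L, hL⟩ := hf
  exact ⟨⟨C, fun z => hC _⟩, L * K, hL.comp hu⟩

theorem posPart (hf : IsBddLip f) : IsBddLip (fun x => max (f x) 0) := by
  obtain ⟨⟨C, hC⟩, K, hK⟩ := hf
  refine ⟨⟨C, fun z => ?_⟩, K, hK.max_const 0⟩
  refine le_trans ?_ (hC z)
  rw [abs_of_nonneg (le_max_right _ _)]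
  exact max_le (le_abs_self _) (abs_nonneg _)

theorem clip {L : ℝ} (hL : 0 ≤ L) : IsBddLip (fun x : ℝ => max (-L) (min x L)) := by
  refine ⟨⟨L, fun z => abs_le.2 ⟨le_max_left _ _, max_le (by linarith) (min_le_right _ _)⟩⟩, 1, ?_⟩
  exact (LipschitzWith.id.min_const L).const_max (-L)

theorem thickenedIndicator {δ : ℝ} (hδ : 0 < δ) (F : Set α) :
    IsBddLip (fun x => (_root_.thickenedIndicator hδ F x : ℝ)) := by
  refine ⟨⟨1, fun z => ?_⟩, _,
    (LipschitzWith.of_dist_le_mul (K := 1) fun x y => by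
      rw [NNReal.coe_one, one_mul]; exact le_of_eq rfl).comp
      (lipschitzWith_thickenedIndicator hδ F)⟩
  rw [abs_of_nonneg (NNReal.coe_nonneg _)]
  exact_mod_cast thickenedIndicator_le_one hδ F z

theorem continuous (hf : IsBddLip f) : Continuous f := hf.2.choose_spec.continuous

end IsBddLip

/-- Bounded Lipschitz functions of the first `n` coordinates. -/
def CylBddLip (n : ℕ) (X : (ℕ → ℝ) → ℝ) : Prop :=
  ∃ f : (Fin n → ℝ) → ℝ, IsBddLip f ∧ X = fun ω => f (fun i => ω i)

namespace CylBddLip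

variable {n : ℕ} {X Y : (ℕ → ℝ) → ℝ}

theorem const (c : ℝ) : CylBddLip n (fun _ => c) := ⟨_, IsBddLip.const c, rfl⟩

theorem add (hX : CylBddLip n X) (hY : CylBddLip n Y) : CylBddLip n (fun ω => X ω + Y ω) := by
  obtain ⟨f, hf, rfl⟩ := hX
  obtain ⟨g, hg, rfl⟩ := hY
  exact ⟨_, hf.add hg, rfl⟩

theorem neg (hX : CylBddLip n X) : CylBddLip n (fun ω => - X ω) := by
  obtain ⟨f, hf, rfl⟩ := hX
  exact ⟨_, hf.neg, rfl⟩

theorem sub (hX : CylBddLip n X) (hY : CylBddLip n Y) : CylBddLip n (fun ω => X ω - Y ω) := by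
  obtain ⟨f, hf, rfl⟩ := hX
  obtain ⟨g, hg, rfl⟩ := hY
  exact ⟨_, hf.sub hg, rfl⟩

theorem mul (hX : CylBddLip n X) (hY : CylBddLip n Y) : CylBddLip n (fun ω => X ω * Y ω) := by
  obtain ⟨f, hf, rfl⟩ := hX
  obtain ⟨g, hg, rfl⟩ := hY
  exact ⟨_, hf.mul hg, rfl⟩

theorem posPart (hX : CylBddLip n X) : CylBddLip n (fun ω => max (X ω) 0) := by
  obtain ⟨f, hf, rfl⟩ := hX
  exact ⟨_, hf.posPart, rfl⟩

theorem mono {m : ℕ} (hX : CylBddLip n X) (h : n ≤ m) : CylBddLip m X := by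
  obtain ⟨f, hf, rfl⟩ := hX
  refine ⟨fun x => f (fun i => x (Fin.castLE h i)), hf.comp (K := 1) ?_, rfl⟩
  refine LipschitzWith.of_dist_le_mul fun x y => ?_
  rw [NNReal.coe_one, one_mul]
  exact (dist_pi_le_iff dist_nonneg).2 fun i => dist_le_pi_dist x y _

theorem coord {χ : ℝ → ℝ} (hχ : IsBddLip χ) {k : ℕ} (hk : k < n) :
    CylBddLip n (fun ω => χ (ω k)) :=
  ⟨fun x => χ (x ⟨k, hk⟩), hχ.comp (LipschitzWith.eval _), rfl⟩

theorem continuous (hX : CylBddLip n X) : Continuous X := by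
  obtain ⟨f, hf, rfl⟩ := hX
  exact hf.continuous.comp (by fun_prop)

theorem exists_bcf (hX : CylBddLip n X) :
    ∃ Y : BoundedContinuousFunction (ℕ → ℝ) ℝ, ⇑Y = X := by
  have hc := hX.continuous
  obtain ⟨f, ⟨⟨C, hC⟩, _⟩, rfl⟩ := hX
  exact ⟨BoundedContinuousFunction.ofNormedAddCommGroup _ hc C fun ω => hC _, rfl⟩

theorem measurable_comap (hX : CylBddLip n X) :
    Measurable[MeasurableSpace.comap (fun (ω : ℕ → ℝ) (i : Fin n) => ω i) inferInstance] X := by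
  obtain ⟨f, hf, rfl⟩ := hX
  exact hf.continuous.measurable.comp (comap_measurable _)

end CylBddLip

/-! ### Representation of the expectation and centred perturbations -/

namespace SublinearExpectation

section General

variable {Ω : Type*} [TopologicalSpace Ω] (E : SublinearExpectation Ω)

theorem const_add (c : ℝ) (X : BoundedContinuousFunction Ω ℝ) :
    E (BoundedContinuousFunction.const Ω c + X) = c + E X := by
  apply le_antisymm
  · simpa [E.const'] using E.add_le' (BoundedContinuousFunction.const Ω c) X
  · have := E.add_le' (BoundedContinuousFunction.const Ω (-c))
      (BoundedContinuousFunction.const Ω c + X)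
    rw [E.const'] at this
    have h2 : BoundedContinuousFunction.const Ω (-c) + (BoundedContinuousFunction.const Ω c + X)
        = X := by ext; simp
    rw [h2] at this
    linarith

variable [MeasurableSpace Ω] {E} {Θ₀ : Set (ProbabilityMeasure Ω)}

theorem IsRepresentedBy.nonempty (h : E.IsRepresentedBy Θ₀) : Θ₀.Nonempty := by
  rw [Set.nonempty_iff_ne_empty]
  rintro rfl
  have := h 0
  rw [Set.image_empty, isLUB_empty_iff] at this
  exact not_isBot _ this

theorem IsRepresentedBy.subset_maximalSet (h : E.IsRepresentedBy Θ₀) : Θ₀ ⊆ E.maximalSet :=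
  fun P hP X => (h X).1 ⟨P, hP, rfl⟩

theorem bddAbove_integral (X : BoundedContinuousFunction Ω ℝ) :
    BddAbove (Set.range fun P : E.maximalSet =>
      ∫ ω, X ω ∂((P : ProbabilityMeasure Ω) : Measure Ω)) :=
  ⟨E X, by rintro _ ⟨P, rfl⟩; exact P.2 X⟩

theorem IsRepresentedBy.expect_eq (h : E.IsRepresentedBy Θ₀) (X : BoundedContinuousFunction Ω ℝ) :
    E.expect X = E X := by
  obtain ⟨P₀, hP₀⟩ := h.nonempty
  have : Nonempty E.maximalSet := ⟨⟨P₀, h.subset_maximalSet hP₀⟩⟩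
  apply le_antisymm
  · exact ciSup_le fun P => P.2 X
  · refine (h X).2 ?_
    rintro _ ⟨P, hP, rfl⟩
    exact le_ciSup (bddAbove_integral X) ⟨P, h.subset_maximalSet hP⟩

theorem integral_le_expect {P : ProbabilityMeasure Ω} (hP : P ∈ E.maximalSet)
    (X : BoundedContinuousFunction Ω ℝ) : ∫ ω, X ω ∂(P : Measure Ω) ≤ E.expect X :=
  le_ciSup (bddAbove_integral X) ⟨P, hP⟩

theorem IsRepresentedBy.expect_const_add (h : E.IsRepresentedBy Θ₀)
    (X : BoundedContinuousFunction Ω ℝ) (c : ℝ) :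
    E.expect (fun ω => c + X ω) = c + E.expect X := by
  rw [h.expect_eq, ← E.const_add, ← h.expect_eq]
  rfl

theorem IsRepresentedBy.expect_const_mul (h : E.IsRepresentedBy Θ₀)
    (X : BoundedContinuousFunction Ω ℝ) {c : ℝ} (hc : 0 ≤ c) :
    E.expect (fun ω => c * X ω) = c * E.expect X := by
  rw [h.expect_eq, ← E.smul' c X hc, ← h.expect_eq]
  rfl

/-- Positive homogeneity, applied to `-X` when `c` is negative. The right side is the recentring
term in `centered`. -/
theorem IsRepresentedBy.expect_mul (h : E.IsRepresentedBy Θ₀)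
    (X : BoundedContinuousFunction Ω ℝ) (c : ℝ) :
    E.expect (fun ω => c * X ω) =
      max c 0 * E.expect X + max (-c) 0 * E.expect (fun ω => - X ω) := by
  rcases le_total 0 c with hc | hc
  · rw [h.expect_const_mul X hc, max_eq_left hc, max_eq_right (neg_nonpos.2 hc)]; ring
  · have := h.expect_const_mul (-X) (neg_nonneg.2 hc)
    simp only [BoundedContinuousFunction.coe_neg, Pi.neg_apply, neg_mul_neg] at this
    rw [this, max_eq_right hc, max_eq_left (neg_nonneg.2 hc), zero_mul, zero_add]
    rfl

end General

section Sequence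

variable {E : SublinearExpectation (ℕ → ℝ)} {Θ₀ : Set (ProbabilityMeasure (ℕ → ℝ))}

/-- `s * χ(ω n)` recentred by its worst-case conditional mean. -/
noncomputable def centered (E : SublinearExpectation (ℕ → ℝ)) (s : (ℕ → ℝ) → ℝ) (χ : ℝ → ℝ)
    (n : ℕ) (ω : ℕ → ℝ) : ℝ :=
  s ω * χ (ω n) - (max (s ω) 0 * E.expect (fun ω' => χ (ω' n)) +
    max (-s ω) 0 * E.expect (fun ω' => - χ (ω' n)))

theorem cylBddLip_centered {n : ℕ} {s : (ℕ → ℝ) → ℝ} (hs : CylBddLip n s) {χ : ℝ → ℝ}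
    (hχ : IsBddLip χ) : CylBddLip (n + 1) (E.centered s χ n) := by
  have hs' := hs.mono n.le_succ
  exact (hs'.mul (.coord hχ n.lt_succ_self)).sub
    ((hs'.posPart.mul (.const _)).add (hs'.neg.posPart.mul (.const _)))

/-- Independence allows the past to be frozen at `y` in the inner expectation. There `H y` and `s y`
are constants, and the upper mean of `s y * χ` is exactly what `centered` subtracts. -/
theorem IsRepresentedBy.expect_add_centered (h : E.IsRepresentedBy Θ₀)
    (hiid : E.IsIID (fun k ω => ω k)) {n : ℕ} {H s : (ℕ → ℝ) → ℝ} (hH : CylBddLip n H)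
    (hs : CylBddLip n s) {χ : ℝ → ℝ} (hχ : IsBddLip χ) :
    E.expect (fun ω => H ω + E.centered s χ n ω) = E.expect H := by
  obtain ⟨H, hH, rfl⟩ := hH
  obtain ⟨s, hs, rfl⟩ := hs
  set M := E.expect (fun ω' => χ (ω' n)) with hM
  set m := E.expect (fun ω' => - χ (ω' n)) with hm
  obtain ⟨Y, hY⟩ := (CylBddLip.coord hχ n.lt_succ_self).exists_bcf
  let φ : (Fin n → ℝ) × (Fin 1 → ℝ) → ℝ := fun z =>
    H z.1 + (s z.1 * χ (z.2 0) - (max (s z.1) 0 * M + max (-s z.1) 0 * m))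
  have hφ : IsBddLip φ := by
    have hs1 : IsBddLip (fun z : (Fin n → ℝ) × (Fin 1 → ℝ) => s z.1) :=
      hs.comp LipschitzWith.prod_fst
    have hH1 : IsBddLip (fun z : (Fin n → ℝ) × (Fin 1 → ℝ) => H z.1) :=
      hH.comp LipschitzWith.prod_fst
    have hχ1 : IsBddLip (fun z : (Fin n → ℝ) × (Fin 1 → ℝ) => χ (z.2 0)) :=
      hχ.comp ((LipschitzWith.eval (0 : Fin 1)).comp LipschitzWith.prod_snd)
    exact hH1.add ((hs1.mul hχ1).sub
      ((hs1.posPart.mul (.const _)).add (hs1.neg.posPart.mul (.const _))))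
  have key := hiid.1 n φ hφ.1 hφ.2
  refine key.trans ?_
  congr 1
  funext ω
  set y : Fin n → ℝ := fun i => ω i
  have h1 := h.expect_const_add (s y • Y) (H y - (max (s y) 0 * M + max (-s y) 0 * m))
  have h2 := h.expect_mul Y (s y)
  have h3 : ∀ ω' : ℕ → ℝ, Y ω' = χ (ω' n) := fun ω' => congrFun hY ω'
  have h4 : (⇑(s y • Y) : (ℕ → ℝ) → ℝ) = fun ω' => s y * Y ω' := rfl
  rw [h4, h2] at h1
  simp only [h3, hY] at h1
  calc E.expect (fun ω' => φ (y, fun _ => ω' n))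
      = E.expect (fun ω' => H y - (max (s y) 0 * M + max (-s y) 0 * m) + (s y • Y) ω') := by
        congr 1; funext ω'
        show H y + (s y * χ (ω' n) - (max (s y) 0 * M + max (-s y) 0 * m)) = _
        simp only [h4, h3]; ring
    _ = H y - (max (s y) 0 * M + max (-s y) 0 * m) + (max (s y) 0 * M + max (-s y) 0 * m) := by
        rw [h4]; simp only [h3]; exact h1
    _ = H y := by ring

/-- The case `H = 0` of the preceding identity, combined with domination of `P` by `E`. -/
theorem IsRepresentedBy.integral_centered_nonpos (h : E.IsRepresentedBy Θ₀)
    (hiid : E.IsIID (fun k ω => ω k)) {P : ProbabilityMeasure (ℕ → ℝ)} (hP : P ∈ E.maximalSet)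
    {n : ℕ} {s : (ℕ → ℝ) → ℝ} (hs : CylBddLip n s) {χ : ℝ → ℝ} (hχ : IsBddLip χ) :
    ∫ ω, E.centered s χ n ω ∂(P : Measure (ℕ → ℝ)) ≤ 0 := by
  obtain ⟨Y, hY⟩ := (cylBddLip_centered (E := E) hs hχ).exists_bcf
  have h1 := integral_le_expect hP Y
  have h2 := h.expect_add_centered hiid (CylBddLip.const 0) hs hχ
  have h3 : E.expect (fun _ : ℕ → ℝ => (0 : ℝ)) = 0 := by
    have := h.expect_eq (BoundedContinuousFunction.const _ 0)
    rw [E.const'] at this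
    exact this
  simp only [zero_add, h3] at h2
  rw [hY] at h1
  exact h1.trans_eq h2

theorem expect_coord_eq (hiid : E.IsIID (fun k ω => ω k)) {χ : ℝ → ℝ} (hχ : IsBddLip χ) (n : ℕ) :
    E.expect (fun ω => χ (ω n)) = E.expect (fun ω => χ (ω 0)) := by
  induction n with
  | zero => rfl
  | succ n ih => exact (hiid.2 n χ hχ.1 hχ.2).trans ih

end Sequence

end SublinearExpectation

/-! ### Selection of a face by Zorn's lemma -/

namespace SublinearExpectation

section Selection

variable {Ω : Type*} [TopologicalSpace Ω] [MeasurableSpace Ω]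

/-- `K` is stable for the test functions `H` and the perturbations `𝒵`: adding a perturbation
never decreases the upper integral over `K` of a test function. -/
def IsStable (H : Submodule ℝ (BoundedContinuousFunction Ω ℝ))
    (𝒵 : Set (BoundedContinuousFunction Ω ℝ)) (K : Set (ProbabilityMeasure Ω)) : Prop :=
  ∀ Z ∈ 𝒵, ∀ f ∈ H, ∀ P ∈ K, ∃ P' ∈ K,
    ∫ ω, f ω ∂(P : Measure Ω) ≤ ∫ ω, f ω ∂(P' : Measure Ω) + ∫ ω, Z ω ∂(P' : Measure Ω)

variable [OpensMeasurableSpace Ω] {H : Submodule ℝ (BoundedContinuousFunction Ω ℝ)}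
  {𝒵 : Set (BoundedContinuousFunction Ω ℝ)} {K : Set (ProbabilityMeasure Ω)}

/-- Penalisation: stability for `n • f + g` gives measures whose deficit in `f` is of order `1 / n`.
By compactness some measure has no deficit and still satisfies the inequality for `g`. -/
theorem IsStable.argmax [T2Space (ProbabilityMeasure Ω)] (hK : IsStable H 𝒵 K) (hc : IsCompact K)
    {f : BoundedContinuousFunction Ω ℝ} (hf : f ∈ H) {P₀ : ProbabilityMeasure Ω}
    (hmax : ∀ P ∈ K, ∫ ω, f ω ∂(P : Measure Ω) ≤ ∫ ω, f ω ∂(P₀ : Measure Ω)) :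
    IsStable H 𝒵 {P ∈ K | ∫ ω, f ω ∂(P : Measure Ω) = ∫ ω, f ω ∂(P₀ : Measure Ω)} := by
  rintro Z hZ g hg P ⟨hPK, hPf⟩
  have hcont := fun X : BoundedContinuousFunction Ω ℝ =>
    ProbabilityMeasure.continuous_integral_boundedContinuousFunction X
  set a := ∫ ω, f ω ∂(P₀ : Measure Ω) with ha
  -- These sets decrease because the deficit is nonnegative. `T 0` is the wanted inequality for `g`,
  -- and membership in all `T n` makes the deficit vanish.
  let T : ℕ → Set (ProbabilityMeasure Ω) := fun n => K ∩ {P' | (n : ℝ) *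
    (a - ∫ ω, f ω ∂(P' : Measure Ω)) ≤ ∫ ω, g ω ∂(P' : Measure Ω) +
      ∫ ω, Z ω ∂(P' : Measure Ω) - ∫ ω, g ω ∂(P : Measure Ω)}
  have hcl : ∀ n, IsClosed (T n) := fun n => hc.isClosed.inter <| isClosed_le
    (continuous_const.mul (continuous_const.sub (hcont f)))
    (((hcont g).add (hcont Z)).sub continuous_const)
  obtain ⟨P', hP'⟩ := IsCompact.nonempty_iInter_of_sequence_nonempty_isCompact_isClosed T
    (fun n P' hP' => ⟨hP'.1, by
      have h1 := hP'.2
      have h2 := hmax P' hP'.1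
      simp only [Set.mem_ofPred_eq] at h1 ⊢
      push_cast at h1
      nlinarith⟩)
    (fun n => by
      obtain ⟨P', hP'K, hP'⟩ := hK Z hZ ((n : ℝ) • f + g)
        (H.add_mem (H.smul_mem _ hf) hg) P hPK
      refine ⟨P', hP'K, ?_⟩
      have hint : ∀ Q : ProbabilityMeasure Ω, ∫ ω, ((n : ℝ) • f + g) ω ∂(Q : Measure Ω) =
          n * ∫ ω, f ω ∂(Q : Measure Ω) + ∫ ω, g ω ∂(Q : Measure Ω) := fun Q => by
        simp only [BoundedContinuousFunction.coe_add, BoundedContinuousFunction.coe_smul,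
          Pi.add_apply, smul_eq_mul]
        rw [integral_add ((f.integrable _).const_mul _) (g.integrable _), integral_const_mul]
      rw [hint, hint, hPf] at hP'
      simp only [Set.mem_ofPred_eq]
      linarith)
    (hc.inter_right ((hcl 0).preimage continuous_id) |>.of_isClosed_subset (hcl 0)
      fun x hx => ⟨hx.1, hx⟩) hcl
  rw [Set.mem_iInter] at hP'
  refine ⟨P', ⟨(hP' 0).1, le_antisymm (hmax P' (hP' 0).1) ?_⟩, ?_⟩
  · by_contra hlt
    push Not at hlt
    obtain ⟨n, hn⟩ := exists_nat_gt ((∫ ω, g ω ∂(P' : Measure Ω) +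
      ∫ ω, Z ω ∂(P' : Measure Ω) - ∫ ω, g ω ∂(P : Measure Ω)) /
        (a - ∫ ω, f ω ∂(P' : Measure Ω)))
    rw [div_lt_iff₀ (by linarith)] at hn
    exact absurd (hP' n).2 (not_le.2 hn)
  · have := (hP' 0).2
    simp only [Set.mem_ofPred_eq, Nat.cast_zero, zero_mul] at this
    linarith

/-- For fixed `Z`, `f` and `P`, the witnesses in the members of the chain form a directed family of
nonempty compact sets. -/
theorem IsStable.sInter [T2Space (ProbabilityMeasure Ω)] {c : Set (Set (ProbabilityMeasure Ω))}
    (hc : IsChain (· ⊆ ·) c) (hne : c.Nonempty)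
    (h : ∀ K ∈ c, IsCompact K ∧ IsStable H 𝒵 K) : IsStable H 𝒵 (⋂₀ c) := by
  intro Z hZ f hf P hP
  have hcont := fun X : BoundedContinuousFunction Ω ℝ =>
    ProbabilityMeasure.continuous_integral_boundedContinuousFunction X
  have : Nonempty c := hne.to_subtype
  have hcl : IsClosed {P' : ProbabilityMeasure Ω | ∫ ω, f ω ∂(P : Measure Ω) ≤
      ∫ ω, f ω ∂(P' : Measure Ω) + ∫ ω, Z ω ∂(P' : Measure Ω)} :=
    isClosed_le continuous_const ((hcont f).add (hcont Z))
  obtain ⟨P', hP'⟩ := IsCompact.nonempty_iInter_of_directed_nonempty_isCompact_isClosed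
    (fun K : c => (K : Set (ProbabilityMeasure Ω)) ∩
      {P' : ProbabilityMeasure Ω | ∫ ω, f ω ∂(P : Measure Ω) ≤
      ∫ ω, f ω ∂(P' : Measure Ω) + ∫ ω, Z ω ∂(P' : Measure Ω)})
    (fun K L => by
      rcases hc.total K.2 L.2 with hKL | hKL
      · exact ⟨K, subset_rfl, Set.inter_subset_inter_left _ hKL⟩
      · exact ⟨L, Set.inter_subset_inter_left _ hKL, subset_rfl⟩)
    (fun K => (h K K.2).2 Z hZ f hf P (hP K K.2))
    (fun K => (h K K.2).1.inter_right hcl)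
    (fun K => (h K K.2).1.isClosed.inter hcl)
  rw [Set.mem_iInter] at hP'
  exact ⟨P', fun K hK => (hP' ⟨K, hK⟩).1, (hP' ⟨_, hne.some_mem⟩).2⟩

/-- A representing compact set contains a compact set on which all test functions in `H` have
constant integrals, and on which every perturbation that does not decrease the upper expectations
of the test functions still has a nonnegative integral. -/
theorem IsRepresentedBy.exists_face [T2Space (ProbabilityMeasure Ω)] {E : SublinearExpectation Ω}
    {Θ₀ : Set (ProbabilityMeasure Ω)} (h : E.IsRepresentedBy Θ₀) (hc : IsCompact Θ₀)
    (H : Submodule ℝ (BoundedContinuousFunction Ω ℝ)) :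
    ∃ K ⊆ Θ₀, IsCompact K ∧ K.Nonempty ∧
      (∀ f ∈ H, ∀ P ∈ K, ∀ P' ∈ K, ∫ ω, f ω ∂(P : Measure Ω) = ∫ ω, f ω ∂(P' : Measure Ω)) ∧
      ∀ Z : BoundedContinuousFunction Ω ℝ, (∀ f ∈ H, E f ≤ E (f + Z)) →
        ∃ P ∈ K, 0 ≤ ∫ ω, Z ω ∂(P : Measure Ω) := by
  have hcont := fun X : BoundedContinuousFunction Ω ℝ =>
    ProbabilityMeasure.continuous_integral_boundedContinuousFunction X
  let 𝒵 : Set (BoundedContinuousFunction Ω ℝ) := {Z | ∀ f ∈ H, E f ≤ E (f + Z)}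
  obtain ⟨K, hKΘ, hK⟩ := zorn_superset_nonempty
    {K : Set (ProbabilityMeasure Ω) | IsCompact K ∧ K.Nonempty ∧ IsStable H 𝒵 K}
    (fun c hcS hch hne => by
      have : Nonempty c := hne.to_subtype
      refine ⟨⋂₀ c, ⟨?_, ?_, IsStable.sInter hch hne fun K hK => ⟨(hcS hK).1, (hcS hK).2.2⟩⟩,
        fun s hs => Set.sInter_subset_of_mem hs⟩
      · exact (hcS hne.some_mem).1.of_isClosed_subset
          (isClosed_sInter fun s hs => (hcS hs).1.isClosed) (Set.sInter_subset_of_mem hne.some_mem)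
      · exact IsCompact.nonempty_sInter_of_directed_nonempty_isCompact_isClosed
          (fun K hK L hL => by
            rcases hch.total hK hL with hKL | hKL
            · exact ⟨K, hK, subset_rfl, hKL⟩
            · exact ⟨L, hL, hKL, subset_rfl⟩)
          (fun U hU => (hcS hU).2.1) (fun U hU => (hcS hU).1) (fun U hU => (hcS hU).1.isClosed))
    -- `Θ₀` is itself stable: a maximiser of the integral of `f + Z` over it attains at least `E (f
    -- + Z) ≥ E f`.
    Θ₀ ⟨hc, h.nonempty, fun Z hZ f hf P hP => by
      obtain ⟨P', hP', hmax⟩ := hc.exists_isMaxOn h.nonempty (hcont (f + Z)).continuousOn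
      refine ⟨P', hP', ?_⟩
      have h1 : ∫ ω, f ω ∂(P : Measure Ω) ≤ E f := (h f).1 ⟨P, hP, rfl⟩
      have h2 : E (f + Z) ≤ ∫ ω, (f + Z) ω ∂(P' : Measure Ω) := (h (f + Z)).2 (by
        rintro _ ⟨Q, hQ, rfl⟩
        exact hmax hQ)
      rw [← integral_add (f.integrable _) (Z.integrable _)]
      exact h1.trans ((hZ f hf).trans h2)⟩
  obtain ⟨hKc, hKn, hKs⟩ := hK.prop
  refine ⟨K, hKΘ, hKc, hKn, fun f hf P hP P' hP' => ?_, fun Z hZ => ?_⟩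
  · obtain ⟨P₀, hP₀, hmax⟩ := hKc.exists_isMaxOn hKn (hcont f).continuousOn
    -- The maximisers of `f` form a smaller stable compact set, so by minimality they are all of
    -- `K`.
    have hle := hK.le_of_le (y := {P ∈ K | ∫ ω, f ω ∂(P : Measure Ω) = ∫ ω, f ω ∂(P₀ : Measure Ω)})
      ⟨hKc.inter_right (isClosed_eq (hcont f) continuous_const), ⟨P₀, hP₀, rfl⟩,
        hKs.argmax hKc hf fun Q hQ => hmax hQ⟩ (fun Q hQ => hQ.1)
    exact (hle hP).2.trans (hle hP').2.symm
  · obtain ⟨P, hP⟩ := hKn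
    obtain ⟨P', hP', hle⟩ := hKs Z hZ 0 H.zero_mem P hP
    refine ⟨P', hP', by simpa using hle⟩

end Selection

end SublinearExpectation

/-! ### From Lipschitz test functions to laws and conditional expectations -/

/-- Finite Borel measures that agree on bounded Lipschitz functions are equal. -/
theorem MeasureTheory.Measure.ext_of_forall_integral_isBddLip {α : Type*} [PseudoMetricSpace α]
    [MeasurableSpace α] [BorelSpace α] {μ ν : Measure α} [IsFiniteMeasure μ] [IsFiniteMeasure ν]
    (h : ∀ f : α → ℝ, IsBddLip f → ∫ x, f x ∂μ = ∫ x, f x ∂ν) : μ = ν := by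
  have hcl : ∀ F : Set α, IsClosed F → μ F = ν F := by
    intro F hF
    have key := fun (ρ : Measure α) [IsFiniteMeasure ρ] =>
      tendsto_integral_thickenedIndicator_of_isClosed ρ hF (δs := fun n : ℕ => 1 / ((n : ℝ) + 1))
        (fun _ => Nat.one_div_pos_of_nat) tendsto_one_div_add_atTop_nhds_zero_nat
    have h1 := key μ
    have h2 := key ν
    have heq := tendsto_nhds_unique (h1.congr fun n => h _ (IsBddLip.thickenedIndicator _ F)) h2
    exact (measureReal_eq_measureReal_iff).1 heq
  refine ext_of_generate_finite _ ?_ isPiSystem_isClosed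
    (fun F hF => hcl F hF) (hcl _ isClosed_univ)
  rw [BorelSpace.measurable_eq (α := α), borel_eq_generateFrom_isClosed]

/-- Borel functions are almost everywhere limits of bounded Lipschitz functions. -/
theorem exists_isBddLip_tendsto_ae {d : ℕ} (μ : Measure (Fin d → ℝ)) [IsProbabilityMeasure μ]
    {f : (Fin d → ℝ) → ℝ} (hf : MemLp f 1 μ) :
    ∃ p : ℕ → (Fin d → ℝ) → ℝ, (∀ n, IsBddLip (p n)) ∧
      ∀ᵐ x ∂μ, Tendsto (fun n => p n x) atTop (𝓝 (f x)) := by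
  have hex : ∀ n : ℕ, ∃ g : (Fin d → ℝ) → ℝ, IsBddLip g ∧
      eLpNorm (g - f) 1 μ ≤ ENNReal.ofReal (1 / ((n : ℝ) + 1)) := by
    intro n
    obtain ⟨g, hg1, hg2, hg3⟩ := hf.exist_eLpNorm_sub_le ENNReal.one_ne_top le_rfl
      (ε := 1 / ((n : ℝ) + 1)) Nat.one_div_pos_of_nat
    refine ⟨g, ⟨?_, hg2.lipschitzWith_of_hasCompactSupport hg1 (by simp)⟩, ?_⟩
    · obtain ⟨C, hC⟩ := hg1.exists_bound_of_continuous hg2.continuous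
      exact ⟨C, hC⟩
    · rwa [eLpNorm_sub_comm]
  choose p hp1 hp2 using hex
  have hlim : Tendsto (fun n => eLpNorm (p n - f) 1 μ) atTop (𝓝 0) := by
    refine tendsto_of_tendsto_of_tendsto_of_le_of_le tendsto_const_nhds ?_ (fun _ => zero_le) hp2
    have := ENNReal.tendsto_ofReal (tendsto_one_div_add_atTop_nhds_zero_nat (𝕜 := ℝ))
    rwa [ENNReal.ofReal_zero] at this
  obtain ⟨ns, _, hns⟩ := (tendstoInMeasure_of_tendsto_eLpNorm one_ne_zero
    (fun n => (hp1 n).continuous.aestronglyMeasurable) hf.1 hlim).exists_seq_tendsto_ae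
  exact ⟨fun n => p (ns n), fun n => hp1 _, hns⟩

/-- The filtration generated by the first `n` coordinates. -/
def coordFiltration : Filtration ℕ (inferInstance : MeasurableSpace (ℕ → ℝ)) where
  seq n := MeasurableSpace.comap (fun (ω : ℕ → ℝ) (i : Fin n) => ω i) inferInstance
  mono' n m h := by
    have hm : Measurable (fun (x : Fin m → ℝ) (i : Fin n) => x (Fin.castLE h i)) := by fun_prop
    have hcomp : MeasurableSpace.comap (fun (ω : ℕ → ℝ) (i : Fin n) => ω i) inferInstance =
        MeasurableSpace.comap (fun (ω : ℕ → ℝ) (i : Fin m) => ω i)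
          (MeasurableSpace.comap (fun (x : Fin m → ℝ) (i : Fin n) => x (Fin.castLE h i))
            inferInstance) := by
      rw [MeasurableSpace.comap_comp]; rfl
    refine hcomp.trans_le ?_
    exact MeasurableSpace.comap_mono hm.comap_le
  le' n := by
    have hm : Measurable (fun (ω : ℕ → ℝ) (i : Fin n) => ω i) := by fun_prop
    exact hm.comap_le

theorem CylBddLip.stronglyMeasurable {n : ℕ} {X : (ℕ → ℝ) → ℝ} (hX : CylBddLip n X) :
    StronglyMeasurable[coordFiltration n] X :=
  Measurable.stronglyMeasurable hX.measurable_comap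

/-- A random variable with nonpositive integrals against nonnegative bounded Lipschitz functions of
the first `n` coordinates has nonpositive integrals over events depending on these coordinates. -/
theorem setIntegral_nonpos_of_cylBddLip {P : Measure (ℕ → ℝ)} [IsProbabilityMeasure P] {n : ℕ}
    {Y : (ℕ → ℝ) → ℝ} {C : ℝ} (hY : Integrable Y P) (hC : ∀ ω, |Y ω| ≤ C)
    (h : ∀ ψ, CylBddLip n ψ → (∀ ω, 0 ≤ ψ ω) → ∫ ω, ψ ω * Y ω ∂P ≤ 0)
    {A : Set (ℕ → ℝ)} (hA : MeasurableSet[coordFiltration n] A) : ∫ ω in A, Y ω ∂P ≤ 0 := by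
  set y : (ℕ → ℝ) → Fin n → ℝ := fun ω i => ω i with hy
  have hym : Measurable y := by fun_prop
  have hclosed : ∀ F : Set (Fin n → ℝ), IsClosed F → ∫ ω in y ⁻¹' F, Y ω ∂P ≤ 0 := by
    intro F hF
    have hδ : ∀ k : ℕ, 0 < 1 / ((k : ℝ) + 1) := fun _ => Nat.one_div_pos_of_nat
    have hlim : ∀ ω, Tendsto (fun k : ℕ => (thickenedIndicator (hδ k) F (y ω) : ℝ) * Y ω) atTop
        (𝓝 ((y ⁻¹' F).indicator Y ω)) := by
      intro ω
      have h1 := thickenedIndicator_tendsto_indicator_closure hδ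
        tendsto_one_div_add_atTop_nhds_zero_nat F
      rw [tendsto_pi_nhds, hF.closure_eq] at h1
      have h2 := ((NNReal.continuous_coe.tendsto _).comp (h1 (y ω))).mul_const (Y ω)
      convert! h2 using 2
      by_cases hω : y ω ∈ F
      · rw [Set.indicator_of_mem hω, Set.indicator_of_mem (show ω ∈ y ⁻¹' F from hω)]; simp
      · rw [Set.indicator_of_notMem hω, Set.indicator_of_notMem (show ω ∉ y ⁻¹' F from hω)]; simp
    have hdom := tendsto_integral_of_dominated_convergence (μ := P) (fun ω => |Y ω|)
      (F := fun k : ℕ => fun ω => (thickenedIndicator (hδ k) F (y ω) : ℝ) * Y ω)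
      (fun k => by
        have : Measurable fun ω => (thickenedIndicator (hδ k) F (y ω) : ℝ) :=
          (IsBddLip.thickenedIndicator (hδ k) F).continuous.measurable.comp hym
        exact this.aestronglyMeasurable.mul hY.1)
      hY.abs
      (fun k => ae_of_all _ fun ω => by
        rw [Real.norm_eq_abs, abs_mul, abs_of_nonneg (NNReal.coe_nonneg _)]
        refine mul_le_of_le_one_left (abs_nonneg _) ?_
        exact_mod_cast thickenedIndicator_le_one (hδ k) F (y ω))
      (ae_of_all _ hlim)
    rw [integral_indicator (hym hF.measurableSet)] at hdom
    exact le_of_tendsto' hdom fun k => h _ ⟨_, IsBddLip.thickenedIndicator (hδ k) F, rfl⟩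
      fun ω => NNReal.coe_nonneg _
  obtain ⟨B, hB, rfl⟩ := hA
  have hC0 : 0 ≤ C := (abs_nonneg _).trans (hC 0)
  by_contra hpos
  push Not at hpos
  set η := ∫ ω in y ⁻¹' B, Y ω ∂P with hη
  have : IsProbabilityMeasure (P.map y) := Measure.isProbabilityMeasure_map hym.aemeasurable
  -- Inner regularity: the part of `B` outside `F` contributes less than `η`, while `F` contributes
  -- nothing positive. The `+ 1` covers `C = 0`.
  obtain ⟨F, hFB, hF, hlt⟩ := hB.exists_isClosed_sdiff_lt (μ := P.map y) (measure_ne_top _ _)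
    (ε := ENNReal.ofReal (η / (C + 1))) (by
      have : 0 < η / (C + 1) := by positivity
      simpa using this)
  rw [Measure.map_apply hym (hB.diff hF.measurableSet)] at hlt
  have hsplit : η = ∫ ω in y ⁻¹' F, Y ω ∂P + ∫ ω in y ⁻¹' (B \ F), Y ω ∂P := by
    rw [hη, ← setIntegral_union _ (hym (hB.diff hF.measurableSet)) hY.integrableOn hY.integrableOn,
      ← Set.preimage_union, Set.union_sdiff_cancel hFB]
    exact Disjoint.preimage y Set.disjoint_sdiff_right
  have hrest : ∫ ω in y ⁻¹' (B \ F), Y ω ∂P ≤ C * P.real (y ⁻¹' (B \ F)) :=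
    (Real.le_norm_self _).trans (norm_setIntegral_le_of_norm_le_const (measure_lt_top _ _)
      fun ω _ => hC ω)
  have hreal : P.real (y ⁻¹' (B \ F)) < η / (C + 1) := by
    rw [Measure.real, ← ENNReal.lt_ofReal_iff_toReal_lt (measure_ne_top _ _)]
    exact hlt
  have h1 := hclosed F hF
  rw [lt_div_iff₀ (by positivity)] at hreal
  have h2 : 0 ≤ P.real (y ⁻¹' (B \ F)) := measureReal_nonneg
  nlinarith

/-- The event where the conditional expectation is positive belongs to the filtration, so the
preceding bound applies to it and makes it null. -/
theorem condExp_nonpos_of_cylBddLip {P : Measure (ℕ → ℝ)} [IsProbabilityMeasure P] {n : ℕ}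
    {Y : (ℕ → ℝ) → ℝ} {C : ℝ} (hY : Integrable Y P) (hC : ∀ ω, |Y ω| ≤ C)
    (h : ∀ ψ, CylBddLip n ψ → (∀ ω, 0 ≤ ψ ω) → ∫ ω, ψ ω * Y ω ∂P ≤ 0) :
    P[Y|coordFiltration n] ≤ᵐ[P] 0 := by
  set A : Set (ℕ → ℝ) := {ω | 0 < (P[Y|coordFiltration n]) ω} with hAdef
  have hA : MeasurableSet[coordFiltration n] A :=
    stronglyMeasurable_condExp.measurable measurableSet_Ioi
  have hA' : MeasurableSet A := coordFiltration.le n _ hA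
  have h1 : ∫ ω in A, (P[Y|coordFiltration n]) ω ∂P ≤ 0 := by
    rw [setIntegral_condExp (coordFiltration.le n) hY hA]
    exact setIntegral_nonpos_of_cylBddLip hY hC h hA
  have hnn : 0 ≤ᵐ[P.restrict A] P[Y|coordFiltration n] := by
    filter_upwards [ae_restrict_mem hA'] with ω hω
    exact le_of_lt hω
  have h2 : ∫ ω in A, (P[Y|coordFiltration n]) ω ∂P = 0 :=
    le_antisymm h1 (setIntegral_nonneg_of_ae_restrict hnn)
  rw [setIntegral_eq_zero_iff_of_nonneg_ae hnn integrable_condExp.integrableOn] at h2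
  filter_upwards [(ae_restrict_iff' hA').1 h2] with ω hω
  by_contra hlt
  rw [Pi.zero_apply, not_le] at hlt
  exact hlt.ne' (hω hlt)

/-! ### Conditional means under dominated measures -/

namespace SublinearExpectation

variable {E : SublinearExpectation (ℕ → ℝ)} {Θ₀ : Set (ProbabilityMeasure (ℕ → ℝ))}
  {P : ProbabilityMeasure (ℕ → ℝ)} {χ : ℝ → ℝ}

theorem integrable_coord (hχ : IsBddLip χ) (n : ℕ) :
    Integrable (fun ω => χ (ω n)) (P : Measure (ℕ → ℝ)) := by
  obtain ⟨Y, hY⟩ := (CylBddLip.coord hχ n.lt_succ_self).exists_bcf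
  rw [← hY]
  exact Y.integrable _

/-- The upper conditional mean of `χ (ω n)` given the past is at most its upper mean. -/
theorem IsRepresentedBy.condExp_le (h : E.IsRepresentedBy Θ₀) (hiid : E.IsIID (fun k ω => ω k))
    (hP : P ∈ E.maximalSet) (hχ : IsBddLip χ) (n : ℕ) :
    ∀ᵐ ω ∂(P : Measure (ℕ → ℝ)),
      ((P : Measure (ℕ → ℝ))[fun ω => χ (ω n)|coordFiltration n]) ω ≤
        E.expect (fun ω => χ (ω n)) := by
  set M := E.expect (fun ω => χ (ω n)) with hM
  obtain ⟨C, hC⟩ := hχ.1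
  have hint := integrable_coord (P := P) hχ n
  have key := condExp_nonpos_of_cylBddLip (P := (P : Measure (ℕ → ℝ))) (n := n)
    (Y := fun ω => χ (ω n) - M) (C := C + |M|) (hint.sub (integrable_const M))
    (fun ω => (abs_sub _ _).trans (add_le_add (hC _) le_rfl))
    -- For `ψ ≥ 0` the negative part drops out, and `centered ψ χ n` is just `ψ` times `χ - M`.
    (fun ψ hψ hnn => by
      refine le_trans (le_of_eq ?_) (h.integral_centered_nonpos hiid hP hψ hχ)
      refine integral_congr_ae (ae_of_all _ fun ω => ?_)
      simp only [centered]
      rw [max_eq_left (hnn ω), max_eq_right (neg_nonpos.2 (hnn ω))]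
      ring)
  have hsub := condExp_sub hint (integrable_const M) (coordFiltration n)
  have hconst : (P : Measure (ℕ → ℝ))[fun _ => M|coordFiltration n] = fun _ => M :=
    condExp_const (coordFiltration.le n) M
  rw [hconst] at hsub
  filter_upwards [key, hsub] with ω h1 h2
  have h3 := h2.symm.trans_le h1
  simpa using h3

theorem IsRepresentedBy.le_condExp (h : E.IsRepresentedBy Θ₀) (hiid : E.IsIID (fun k ω => ω k))
    (hP : P ∈ E.maximalSet) (hχ : IsBddLip χ) (n : ℕ) :
    ∀ᵐ ω ∂(P : Measure (ℕ → ℝ)), - E.expect (fun ω => - χ (ω n)) ≤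
      ((P : Measure (ℕ → ℝ))[fun ω => χ (ω n)|coordFiltration n]) ω := by
  filter_upwards [h.condExp_le hiid hP hχ.neg n,
    condExp_neg (μ := (P : Measure (ℕ → ℝ))) (fun ω => χ (ω n)) (coordFiltration n)] with ω h1 h2
  have h3 := h2.symm.trans_le h1
  rw [Pi.neg_apply] at h3
  linarith

/-- If `E.centered s χ n` has nonnegative integral, then the conditional mean of `χ (ω n)` is the
upper mean where `s > 0` and the lower mean where `s < 0`. -/
theorem IsRepresentedBy.condExp_eq_of_integral_centered_nonneg (h : E.IsRepresentedBy Θ₀)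
    (hiid : E.IsIID (fun k ω => ω k)) (hP : P ∈ E.maximalSet) (hχ : IsBddLip χ) {n : ℕ}
    {s : (ℕ → ℝ) → ℝ} (hs : CylBddLip n s)
    (hnn : 0 ≤ ∫ ω, E.centered s χ n ω ∂(P : Measure (ℕ → ℝ))) :
    ∀ᵐ ω ∂(P : Measure (ℕ → ℝ)),
      (0 < s ω → ((P : Measure (ℕ → ℝ))[fun ω => χ (ω n)|coordFiltration n]) ω =
        E.expect (fun ω => χ (ω n))) ∧
      (s ω < 0 → ((P : Measure (ℕ → ℝ))[fun ω => χ (ω n)|coordFiltration n]) ω =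
        - E.expect (fun ω => - χ (ω n))) := by
  set M := E.expect (fun ω => χ (ω n)) with hM
  set m := E.expect (fun ω => - χ (ω n)) with hm
  set c := (P : Measure (ℕ → ℝ))[fun ω => χ (ω n)|coordFiltration n] with hc
  have hgcyl : CylBddLip n (fun ω => max (s ω) 0 * M + max (-s ω) 0 * m) :=
    (hs.posPart.mul (.const _)).add (hs.neg.posPart.mul (.const _))
  obtain ⟨G, hG⟩ := hgcyl.exists_bcf
  have hGint : Integrable (fun ω => max (s ω) 0 * M + max (-s ω) 0 * m)
      (P : Measure (ℕ → ℝ)) := by rw [← hG]; exact G.integrable _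
  obtain ⟨S, hS⟩ := ((hs.mono n.le_succ).mul (.coord hχ n.lt_succ_self)).exists_bcf
  have hSint : Integrable (fun ω => s ω * χ (ω n)) (P : Measure (ℕ → ℝ)) := by
    rw [← hS]; exact S.integrable _
  have hpull : (P : Measure (ℕ → ℝ))[fun ω => s ω * χ (ω n)|coordFiltration n] =ᵐ[(P : Measure (ℕ → ℝ))]
      fun ω => s ω * c ω :=
    condExp_mul_of_stronglyMeasurable_left hs.stronglyMeasurable hSint (integrable_coord hχ n)
  have hscint : Integrable (fun ω => s ω * c ω) (P : Measure (ℕ → ℝ)) :=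
    integrable_condExp.congr hpull
  have heq : ∫ ω, E.centered s χ n ω ∂(P : Measure (ℕ → ℝ)) =
      ∫ ω, (s ω * c ω - (max (s ω) 0 * M + max (-s ω) 0 * m)) ∂(P : Measure (ℕ → ℝ)) := by
    have h1 : ∫ ω, s ω * χ (ω n) ∂(P : Measure (ℕ → ℝ)) =
        ∫ ω, s ω * c ω ∂(P : Measure (ℕ → ℝ)) := by
      rw [← integral_condExp (coordFiltration.le n)]
      exact integral_congr_ae hpull
    rw [integral_sub hscint hGint, ← h1, ← integral_sub hSint hGint]
    rfl
  have hup := h.condExp_le hiid hP hχ n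
  have hlow := h.le_condExp hiid hP hχ n
  -- The two bounds on `c` give this integrand a sign for either sign of `s`. Its integral is
  -- nonpositive by assumption, so it vanishes almost everywhere.
  have hle : ∀ᵐ ω ∂(P : Measure (ℕ → ℝ)),
      0 ≤ -(s ω * c ω - (max (s ω) 0 * M + max (-s ω) 0 * m)) := by
    filter_upwards [hup, hlow] with ω h1 h2
    rcases le_total 0 (s ω) with h0 | h0
    · rw [max_eq_left h0, max_eq_right (neg_nonpos.2 h0)]
      nlinarith
    · rw [max_eq_right h0, max_eq_left (neg_nonneg.2 h0)]
      nlinarith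
  have hzero : ∫ ω, -(s ω * c ω - (max (s ω) 0 * M + max (-s ω) 0 * m))
      ∂(P : Measure (ℕ → ℝ)) = 0 := by
    refine le_antisymm ?_ (integral_nonneg_of_ae hle)
    rw [integral_neg, ← heq]
    linarith
  rw [integral_eq_zero_iff_of_nonneg_ae hle (hscint.sub hGint).neg] at hzero
  filter_upwards [hzero] with ω h0
  rw [Pi.zero_apply] at h0
  constructor
  · intro hs0
    rw [max_eq_left hs0.le, max_eq_right (neg_nonpos.2 hs0.le)] at h0
    exact mul_left_cancel₀ hs0.ne' (by linarith)
  · intro hs0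
    rw [max_eq_right hs0.le, max_eq_left (neg_nonneg.2 hs0.le)] at h0
    exact mul_left_cancel₀ hs0.ne (by linarith)

end SublinearExpectation

/-! ### Strong law for martingale differences -/

/-- A form of **Kronecker's lemma**. -/
theorem tendsto_average_zero_of_tendsto_sum_div {e : ℕ → ℝ} {T : ℝ}
    (h : Tendsto (fun N : ℕ => ∑ n ∈ Finset.range N, e n / ((n : ℝ) + 1)) atTop (𝓝 T)) :
    Tendsto (fun N : ℕ => (N : ℝ)⁻¹ * ∑ n ∈ Finset.range N, e n) atTop (𝓝 0) := by
  set S : ℕ → ℝ := fun N => ∑ n ∈ Finset.range N, e n / ((n : ℝ) + 1) with hS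
  -- Summation by parts: the average of `e` is `S N` minus the Cesàro mean of `S`, and both tend to
  -- `T`.
  have habel : ∀ N : ℕ, ∑ n ∈ Finset.range N, e n = N * S N - ∑ n ∈ Finset.range N, S n := by
    intro N
    induction N with
    | zero => simp
    | succ N ih =>
      have h1 : S (N + 1) = S N + e N / ((N : ℝ) + 1) := Finset.sum_range_succ _ _
      have h2 : (N : ℝ) + 1 ≠ 0 := by positivity
      rw [Finset.sum_range_succ, Finset.sum_range_succ, ih, h1]
      push_cast
      field_simp
      ring
  have h1 : Tendsto (fun N : ℕ => S N - (N : ℝ)⁻¹ * ∑ n ∈ Finset.range N, S n) atTop (𝓝 (T - T)) :=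
    h.sub h.cesaro
  rw [sub_self] at h1
  refine h1.congr' ?_
  filter_upwards [eventually_gt_atTop 0] with N hN
  have : (N : ℝ) ≠ 0 := by positivity
  rw [habel]
  field_simp

namespace MeasureTheory

variable {Ω : Type*} {m0 : MeasurableSpace Ω} {μ : Measure Ω} [IsProbabilityMeasure μ]
  {ℱ : Filtration ℕ m0}

/-- Martingale differences with summable variances have almost surely convergent sums. -/
theorem ae_tendsto_sum_of_condExp_eq_zero {e : ℕ → Ω → ℝ} {v : ℕ → ℝ}
    (hmeas : ∀ n, StronglyMeasurable[ℱ (n + 1)] (e n)) (hL2 : ∀ n, MemLp (e n) 2 μ)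
    (hce : ∀ n, μ[e n|ℱ n] =ᵐ[μ] 0) (hv : Summable v) (hle : ∀ n, ∫ ω, e n ω ^ 2 ∂μ ≤ v n) :
    ∀ᵐ ω ∂μ, ∃ T, Tendsto (fun N => ∑ n ∈ Finset.range N, e n ω) atTop (𝓝 T) := by
  set M : ℕ → Ω → ℝ := fun N => ∑ n ∈ Finset.range N, e n with hM
  have hMsucc : ∀ N, M (N + 1) = M N + e N := fun N => Finset.sum_range_succ _ _
  have hMmeas : ∀ N, StronglyMeasurable[ℱ N] (M N) := fun N =>
    Finset.stronglyMeasurable_sum _ fun n hn =>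
      (hmeas n).mono (ℱ.mono (Nat.succ_le_of_lt (Finset.mem_range.1 hn)))
  have hML2 : ∀ N, MemLp (M N) 2 μ := fun N => memLp_finsetSum' _ fun n _ => hL2 n
  have hint : ∀ N, Integrable (M N) μ := fun N => (hML2 N).integrable (by norm_num)
  have heint : ∀ N, Integrable (e N) μ := fun N => (hL2 N).integrable (by norm_num)
  have hprod : ∀ N, Integrable (M N * e N) μ := fun N => (hML2 N).integrable_mul (hL2 N)
  have horth : ∀ N, ∫ ω, M N ω * e N ω ∂μ = 0 := by
    intro N
    have h1 := condExp_mul_of_stronglyMeasurable_left (hMmeas N) (hprod N) (heint N)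
    have h2 : ∫ ω, (M N * e N) ω ∂μ = ∫ ω, (μ[M N * e N|ℱ N]) ω ∂μ :=
      (integral_condExp (ℱ.le N)).symm
    change ∫ ω, (M N * e N) ω ∂μ = 0
    rw [h2]
    refine integral_eq_zero_of_ae ?_
    filter_upwards [h1, hce N] with ω h3 h4
    rw [h3, Pi.mul_apply, h4]
    simp
  have hsq : ∀ N, ∫ ω, M N ω ^ 2 ∂μ ≤ ∑ n ∈ Finset.range N, v n := by
    intro N
    induction N with
    | zero => simp [hM]
    | succ N ih =>
      rw [Finset.sum_range_succ]
      have h1 : ∀ ω, M (N + 1) ω ^ 2 = M N ω ^ 2 + 2 * (M N ω * e N ω) + e N ω ^ 2 := by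
        intro ω; rw [hMsucc]; simp only [Pi.add_apply]; ring
      simp only [h1]
      have h2 : Integrable (fun ω => 2 * (M N ω * e N ω)) μ := (hprod N).const_mul 2
      have h3 : Integrable (fun ω => M N ω ^ 2 + 2 * (M N ω * e N ω)) μ :=
        (hML2 N).integrable_sq.add h2
      rw [integral_add h3 (hL2 N).integrable_sq, integral_add (hML2 N).integrable_sq h2,
        integral_const_mul, horth]
      linarith [hle N]
  have hv0 : ∀ n, 0 ≤ v n := fun n => (integral_nonneg fun ω => sq_nonneg _).trans (hle n)
  have hmart : Martingale M ℱ μ := martingale_nat hMmeas hint fun N => by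
    have h1 : μ[M N + e N|ℱ N] =ᵐ[μ] μ[M N|ℱ N] + μ[e N|ℱ N] :=
      condExp_add (hint N) (heint N) _
    rw [hMsucc]
    filter_upwards [h1, hce N] with ω h2 h3
    rw [h2, Pi.add_apply, h3, condExp_of_stronglyMeasurable (ℱ.le N) (hMmeas N) (hint N)]
    simp
  -- Orthogonality of increments bounds the second moments; `|x| ≤ 1 + x ^ 2` turns this into the
  -- `L¹` bound needed for martingale convergence.
  have hbdd : ∀ N, eLpNorm (M N) 1 μ ≤ ((1 + ∑' n, v n).toNNReal : ENNReal) := by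
    intro N
    rw [eLpNorm_one_eq_lintegral_enorm, ← ofReal_integral_norm_eq_lintegral_enorm (hint N)]
    refine ENNReal.ofReal_le_ofReal ?_
    have h1 : ∫ ω, ‖M N ω‖ ∂μ ≤ ∫ ω, (1 + M N ω ^ 2) ∂μ := by
      refine integral_mono (hint N).norm ((integrable_const 1).add (hML2 N).integrable_sq)
        fun ω => ?_
      simp only [Real.norm_eq_abs]
      nlinarith [sq_abs (M N ω), sq_nonneg (|M N ω| - 1), abs_nonneg (M N ω)]
    refine h1.trans ?_
    rw [integral_add (integrable_const 1) (hML2 N).integrable_sq]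
    have h2 := (hsq N).trans (hv.sum_le_tsum _ fun n _ => hv0 n)
    simpa using h2
  filter_upwards [hmart.submartingale.ae_tendsto_limitProcess hbdd] with ω hω
  refine ⟨_, hω.congr fun N => ?_⟩
  simp [hM, Finset.sum_apply]

/-- **Strong law of large numbers** for square integrable martingale differences. -/
theorem ae_tendsto_average_zero_of_condExp_eq_zero {e : ℕ → Ω → ℝ} {v : ℕ → ℝ}
    (hmeas : ∀ n, StronglyMeasurable[ℱ (n + 1)] (e n)) (hL2 : ∀ n, MemLp (e n) 2 μ)
    (hce : ∀ n, μ[e n|ℱ n] =ᵐ[μ] 0) (hv : Summable v)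
    (hle : ∀ n : ℕ, ∫ ω, e n ω ^ 2 ∂μ ≤ v n * ((n : ℝ) + 1) ^ 2) :
    ∀ᵐ ω ∂μ, Tendsto (fun N : ℕ => (N : ℝ)⁻¹ * ∑ n ∈ Finset.range N, e n ω) atTop (𝓝 0) := by
  have key := ae_tendsto_sum_of_condExp_eq_zero (μ := μ) (ℱ := ℱ)
    (e := fun n => ((n : ℝ) + 1)⁻¹ • e n) (v := v)
    (fun n => (hmeas n).const_smul _) (fun n => (hL2 n).const_smul _)
    (fun n => by
      filter_upwards [condExp_smul (μ := μ) (((n : ℝ) + 1)⁻¹) (e n) (ℱ n), hce n] with ω h1 h2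
      rw [h1, Pi.smul_apply, h2]
      simp)
    hv (fun n => by
      have h0 : (0 : ℝ) < ((n : ℝ) + 1) ^ 2 := by positivity
      simp only [Pi.smul_apply, smul_eq_mul, mul_pow, integral_const_mul]
      rw [inv_pow, inv_mul_le_iff₀ h0, mul_comm]
      exact hle n)
  filter_upwards [key] with ω hω
  obtain ⟨T, hT⟩ := hω
  refine tendsto_average_zero_of_tendsto_sum_div (T := T) (hT.congr fun N => ?_)
  refine Finset.sum_congr rfl fun n _ => ?_
  simp [div_eq_inv_mul]

end MeasureTheory

/-! ### Deterministic steering of averages -/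

/-- If the increments `x n` have drift at most `q` whenever the average exceeds `q`, bounded drift
otherwise, and noise with vanishing averages, then the averages are asymptotically at most `q`. -/
theorem eventually_average_le_of_drift {x e : ℕ → ℝ} {q B δ : ℝ} (hδ : 0 < δ)
    (he : Tendsto (fun N : ℕ => (N : ℝ)⁻¹ * ∑ n ∈ Finset.range N, e n) atTop (𝓝 0))
    (hx : ∀ᶠ n in atTop, x n ≤ B + e n)
    (hdrift : ∀ᶠ n : ℕ in atTop, n * q < ∑ k ∈ Finset.range n, x k → x n ≤ q + e n) :
    ∀ᶠ N : ℕ in atTop, (∑ n ∈ Finset.range N, x n) / (N : ℝ) ≤ q + 3 * δ := by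
  set S : ℕ → ℝ := fun N => ∑ n ∈ Finset.range N, x n with hS
  set W : ℕ → ℝ := fun N => ∑ n ∈ Finset.range N, e n with hW
  have hSs : ∀ N, S (N + 1) = S N + x N := fun N => Finset.sum_range_succ _ _
  have hWs : ∀ N, W (N + 1) = W N + e N := fun N => Finset.sum_range_succ _ _
  have hWsmall : ∀ᶠ N : ℕ in atTop, |W N| ≤ δ * N := by
    have := (Metric.tendsto_nhds.1 he δ hδ)
    filter_upwards [this, eventually_gt_atTop 0] with N hN hN0
    have hN0' : (0 : ℝ) < N := by exact_mod_cast hN0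
    rw [Real.dist_eq, sub_zero, abs_mul, abs_of_pos (inv_pos.2 hN0'), inv_mul_lt_iff₀ hN0'] at hN
    linarith
  obtain ⟨n₀, hn₀⟩ := eventually_atTop.1 (hWsmall.and (hx.and hdrift))
  set C : ℝ := max (S n₀ - n₀ * q - W n₀) (max (B - q) 0) with hC
  -- Above the level `n * q` a step does not increase the left side. From below that level one step
  -- ends at most at `B - q - W n`, whatever came before.
  have hG : ∀ n, n₀ ≤ n → S n - n * q - W n ≤ C + δ * n := by
    intro n hn
    induction n, hn using Nat.le_induction with
    | base =>
      have : S n₀ - n₀ * q - W n₀ ≤ C := le_max_left _ _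
      have : 0 ≤ δ * n₀ := by positivity
      linarith
    | succ n hn ih =>
      obtain ⟨h1, h2, h3⟩ := hn₀ n hn
      rw [hSs, hWs]
      push_cast
      by_cases hpos : n * q < S n
      · have := h3 hpos
        linarith
      · push Not at hpos
        have h4 : B - q ≤ C := (le_max_left _ _).trans (le_max_right _ _)
        have h5 := (abs_le.1 h1).1
        linarith
  obtain ⟨n₁, hn₁⟩ := exists_nat_gt (C / δ)
  filter_upwards [eventually_ge_atTop (max n₀ n₁), eventually_gt_atTop 0] with N hN hN0
  have hN0' : (0 : ℝ) < N := by exact_mod_cast hN0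
  have h1 := hG N ((le_max_left _ _).trans hN)
  have h2 := (abs_le.1 (hn₀ N ((le_max_left _ _).trans hN)).1).2
  have h3 : C ≤ δ * N := by
    rw [div_lt_iff₀ hδ] at hn₁
    have : (n₁ : ℝ) ≤ N := by exact_mod_cast (le_max_right _ _).trans hN
    nlinarith
  rw [div_le_iff₀ hN0']
  linarith

/-- Averages are driven to the limit `p` of the targets `p n`, if the drift `c n` takes its upper
extreme `b n` below the target, its lower extreme `a n` above the target, and the noise `e n` has
vanishing averages. -/
theorem tendsto_average_of_drift {x e c a b p : ℕ → ℝ} {α β ρ : ℝ}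
    (he : Tendsto (fun N : ℕ => (N : ℝ)⁻¹ * ∑ n ∈ Finset.range N, e n) atTop (𝓝 0))
    (hx : ∀ᶠ n in atTop, x n = c n + e n) (ha : Tendsto a atTop (𝓝 α))
    (hb : Tendsto b atTop (𝓝 β)) (hp : Tendsto p atTop (𝓝 ρ)) (hαρ : α ≤ ρ) (hρβ : ρ ≤ β)
    (hac : ∀ n, a n ≤ c n) (hcb : ∀ n, c n ≤ b n)
    (hup : ∀ᶠ n : ℕ in atTop, ∑ k ∈ Finset.range n, x k < n * p n → c n = b n)
    (hdown : ∀ᶠ n : ℕ in atTop, n * p n < ∑ k ∈ Finset.range n, x k → c n = a n) :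
    Tendsto (fun N : ℕ => (∑ n ∈ Finset.range N, x n) / (N : ℝ)) atTop (𝓝 ρ) := by
  have upper : ∀ ε > 0, ∀ᶠ N : ℕ in atTop, (∑ n ∈ Finset.range N, x n) / (N : ℝ) ≤ ρ + 4 * ε := by
    intro ε hε
    -- The margin `ε` absorbs the convergence of `p` and `a`: an average above `ρ + ε` eventually
    -- exceeds the target `p n`, so the drift is `a n`, which is eventually at most `ρ + ε`.
    have := eventually_average_le_of_drift (x := x) (e := e) (q := ρ + ε) (B := β + 1) hε he
      (by
        filter_upwards [hx, hb.eventually_le_const (lt_add_one β)] with n h1 h2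
        linarith [hcb n])
      (by
        filter_upwards [hx, hdown, ha.eventually_le_const (show α < ρ + ε by linarith),
          hp.eventually_le_const (show ρ < ρ + ε by linarith)] with n h1 h2 h3 h4 h5
        have hn : (0 : ℝ) ≤ n := Nat.cast_nonneg n
        have := h2 (by nlinarith)
        linarith)
    filter_upwards [this] with N hN
    linarith
  have lower : ∀ ε > 0, ∀ᶠ N : ℕ in atTop, ρ - 4 * ε ≤ (∑ n ∈ Finset.range N, x n) / (N : ℝ) := by
    intro ε hε
    have := eventually_average_le_of_drift (x := fun n => - x n) (e := fun n => - e n)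
      (q := - (ρ - ε)) (B := - (α - 1)) hε
      (by simpa using he.neg)
      (by
        filter_upwards [hx, ha.eventually_const_le (sub_one_lt α)] with n h1 h2
        linarith [hac n])
      (by
        filter_upwards [hx, hup, hb.eventually_const_le (show ρ - ε < β by linarith),
          hp.eventually_const_le (show ρ - ε < ρ by linarith)] with n h1 h2 h3 h4 h5
        have hn : (0 : ℝ) ≤ n := Nat.cast_nonneg n
        rw [Finset.sum_neg_distrib] at h5
        have := h2 (by nlinarith)
        linarith)
    filter_upwards [this] with N hN
    rw [Finset.sum_neg_distrib, neg_div] at hN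
    linarith
  refine Metric.tendsto_nhds.2 fun ε hε => ?_
  filter_upwards [upper (ε / 8) (by positivity), lower (ε / 8) (by positivity)] with N h1 h2
  rw [Real.dist_eq, abs_lt]
  constructor <;> linarith

/-! ### Truncation, moments and noise -/

/-- Truncation of a real number to `[-L, L]`. -/
noncomputable def clipAt (L x : ℝ) : ℝ := max (-L) (min x L)

theorem isBddLip_clipAt {L : ℝ} (hL : 0 ≤ L) : IsBddLip (clipAt L) := IsBddLip.clip hL

theorem clipAt_of_abs_le {L x : ℝ} (h : |x| ≤ L) : clipAt L x = x := by
  rw [abs_le] at h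
  rw [clipAt, min_eq_left h.2, max_eq_right h.1]

theorem abs_clipAt {L x : ℝ} (hL : 0 ≤ L) : |clipAt L x| = min |x| L := by
  unfold clipAt
  rcases le_total x L with h | h
  · rw [min_eq_left h]
    rcases le_total (-L) x with h' | h'
    · rw [max_eq_right h', min_eq_left (abs_le.2 ⟨h', h⟩)]
    · rw [max_eq_left h', abs_neg, abs_of_nonneg hL, min_eq_right]
      exact le_trans (by linarith) (neg_le_abs x)
  · rw [min_eq_right h, max_eq_right (by linarith), abs_of_nonneg hL, min_eq_right]
    exact h.trans (le_abs_self x)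

/-- Split the square of `u = min |x| L` as `u ^ (2 - r) * u ^ r`, bounding the first factor through
`L` and the second through `|x|`. -/
theorem clipAt_sq_le {L r : ℝ} (hL : 0 < L) (hr : 0 < r) (hr2 : r ≤ 2) (x : ℝ) :
    clipAt L x ^ 2 ≤ L ^ (2 - r) * |x| ^ r := by
  rw [← sq_abs, abs_clipAt hL.le]
  set u := min |x| L with hu
  have hu0 : 0 ≤ u := le_min (abs_nonneg x) hL.le
  rcases hu0.eq_or_lt with h0 | h0
  · rw [← h0]
    have : 0 ≤ L ^ (2 - r) * |x| ^ r := by positivity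
    simpa using this
  · calc u ^ 2 = u ^ (2 - r) * u ^ r := by
          rw [← Real.rpow_add h0, sub_add_cancel, Real.rpow_two]
      _ ≤ L ^ (2 - r) * |x| ^ r :=
          mul_le_mul (Real.rpow_le_rpow hu0 (min_le_right _ _) (by linarith))
            (Real.rpow_le_rpow hu0 (min_le_left _ _) hr.le) (by positivity) (by positivity)

/-- There is no error unless `|x| ≥ L`, and then `(|x| / L) ^ (r - 1) ≥ 1`. -/
theorem abs_sub_clipAt_le {L r : ℝ} (hL : 0 < L) (hr : 1 ≤ r) (x : ℝ) :
    |x - clipAt L x| ≤ L ^ (1 - r) * |x| ^ r := by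
  rcases le_total |x| L with h | h
  · rw [clipAt_of_abs_le h, sub_self, abs_zero]
    positivity
  · have hx : 0 < |x| := hL.trans_le h
    have h1 : |x - clipAt L x| ≤ |x| := by
      unfold clipAt
      rcases le_total 0 x with h0 | h0
      · rw [abs_of_nonneg h0] at h ⊢
        rw [min_eq_right h, max_eq_right (by linarith), abs_of_nonneg] <;> linarith
      · rw [abs_of_nonpos h0] at h ⊢
        rw [min_eq_left (by linarith), max_eq_left (by linarith), abs_of_nonpos] <;> linarith
    have h2 : |x| = |x| ^ (1 - r) * |x| ^ r := by
      rw [← Real.rpow_add hx, sub_add_cancel, Real.rpow_one]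
    have h3 : |x| ^ (1 - r) ≤ L ^ (1 - r) :=
      Real.rpow_le_rpow_of_nonpos hL h (by linarith)
    calc |x - clipAt L x| ≤ |x| ^ (1 - r) * |x| ^ r := h1.trans h2.le
      _ ≤ L ^ (1 - r) * |x| ^ r := by gcongr

namespace SublinearExpectation

variable {E : SublinearExpectation (ℕ → ℝ)} {Θ₀ : Set (ProbabilityMeasure (ℕ → ℝ))}

/-- Random variables in `L^γ` have uniformly bounded moments of lower orders. -/
theorem MemLp.exists_moment_le {X : (ℕ → ℝ) → ℝ} {γ r : ℝ} (h : E.MemLp γ X) (hr : 1 ≤ r)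
    (hrγ : r ≤ γ) : ∃ R : ℝ, 0 ≤ R ∧ ∀ P ∈ E.maximalSet,
      Integrable X (P : Measure (ℕ → ℝ)) ∧
      Integrable (fun ω => |X ω| ^ r) (P : Measure (ℕ → ℝ)) ∧
      ∫ ω, |X ω| ^ r ∂(P : Measure (ℕ → ℝ)) ≤ R := by
  obtain ⟨hmeas, happrox⟩ := h
  -- One bounded approximant at distance `1` suffices: the triangle inequality bounds the norm of
  -- `X` by `1 + ‖φ‖` for all dominated measures at once.
  obtain ⟨φ, hφ⟩ := happrox 1 one_pos
  have hr0 : 0 < r := by linarith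
  refine ⟨(1 + ‖φ‖) ^ r, by positivity, fun P hP => ?_⟩
  set μ : Measure (ℕ → ℝ) := (P : Measure (ℕ → ℝ)) with hμ
  have hφm : AEStronglyMeasurable φ μ := φ.continuous.aestronglyMeasurable
  have h1 : eLpNorm (fun ω => X ω - φ ω) (ENNReal.ofReal γ) μ ≤ 1 :=
    (le_iSup₂ (f := fun (P : ProbabilityMeasure (ℕ → ℝ)) (_ : P ∈ E.maximalSet) =>
      eLpNorm (fun ω => X ω - φ ω) (ENNReal.ofReal γ) (P : Measure (ℕ → ℝ))) P hP).trans hφ.le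
  have h2 : eLpNorm φ (ENNReal.ofReal γ) μ ≤ ENNReal.ofReal ‖φ‖ := by
    refine (eLpNorm_le_of_ae_bound (ae_of_all _ fun ω => φ.norm_coe_le_norm ω)).trans ?_
    simp
  have h3 : eLpNorm X (ENNReal.ofReal γ) μ ≤ ENNReal.ofReal (1 + ‖φ‖) := by
    have hsum : X = (fun ω => X ω - φ ω) + φ := by ext ω; simp
    rw [hsum, ENNReal.ofReal_add zero_le_one (norm_nonneg _), ENNReal.ofReal_one]
    refine (eLpNorm_add_le (hmeas.aestronglyMeasurable.sub hφm) hφm ?_).trans (add_le_add h1 h2)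
    rw [ENNReal.one_le_ofReal]
    linarith
  have h4 : eLpNorm X (ENNReal.ofReal r) μ ≤ ENNReal.ofReal (1 + ‖φ‖) :=
    (eLpNorm_le_eLpNorm_of_exponent_le (ENNReal.ofReal_le_ofReal hrγ)
      hmeas.aestronglyMeasurable).trans h3
  have hmem : MeasureTheory.MemLp X (ENNReal.ofReal r) μ :=
    ⟨hmeas.aestronglyMeasurable, h4.trans_lt ENNReal.ofReal_lt_top⟩
  have hrne : ENNReal.ofReal r ≠ 0 := by simpa using hr0
  have htr : (ENNReal.ofReal r).toReal = r := ENNReal.toReal_ofReal hr0.le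
  have hint := hmem.integrable_norm_rpow hrne ENNReal.ofReal_ne_top
  rw [htr] at hint
  refine ⟨hmem.integrable (by rw [ENNReal.one_le_ofReal]; exact hr), hint, ?_⟩
  rw [hmem.eLpNorm_eq_integral_rpow_norm hrne ENNReal.ofReal_ne_top, htr,
    ENNReal.ofReal_le_ofReal_iff (by positivity)] at h4
  have h0 : 0 ≤ ∫ ω, ‖X ω‖ ^ r ∂μ := integral_nonneg fun ω => by positivity
  have h5 := Real.rpow_le_rpow (by positivity) h4 hr0.le
  rw [← Real.rpow_mul h0, inv_mul_cancel₀ hr0.ne', Real.rpow_one] at h5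
  exact h5

theorem abs_expect_sub_expect_le [Nonempty E.maximalSet] (X : BoundedContinuousFunction (ℕ → ℝ) ℝ)
    {Y : (ℕ → ℝ) → ℝ} {ε : ℝ} (h : ∀ P ∈ E.maximalSet,
      |∫ ω, X ω ∂(P : Measure (ℕ → ℝ)) - ∫ ω, Y ω ∂(P : Measure (ℕ → ℝ))| ≤ ε) :
    |E.expect X - E.expect Y| ≤ ε := by
  have hX := bddAbove_integral (E := E) X
  -- The real supremum of an unbounded set is `0` by default, so boundedness for `Y` must first be
  -- inherited from `X`.
  have hY : BddAbove (Set.range fun P : E.maximalSet =>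
      ∫ ω, Y ω ∂((P : ProbabilityMeasure (ℕ → ℝ)) : Measure (ℕ → ℝ))) := by
    refine ⟨E X + ε, ?_⟩
    rintro _ ⟨P, rfl⟩
    have h1 := P.2 X
    have h2 := (abs_le.1 (h P P.2)).1
    dsimp only
    linarith
  rw [abs_le]
  constructor
  · have : E.expect Y ≤ E.expect X + ε := ciSup_le fun P => by
      have h1 : _ ≤ E.expect X := le_ciSup hX P
      have h2 := (abs_le.1 (h P P.2)).1
      linarith
    linarith
  · have : E.expect X ≤ E.expect Y + ε := ciSup_le fun P => by
      have h1 : _ ≤ E.expect Y := le_ciSup hY P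
      have h2 := (abs_le.1 (h P P.2)).2
      linarith
    linarith

/-- The upper means of truncations converge to the upper mean; `σ` is a sign. -/
theorem tendsto_expect_clipAt [Nonempty E.maximalSet] {γ : ℝ} (hγ : 1 < γ)
    (hLp : E.MemLp γ (fun ω => ω 0)) {σ : ℝ} (hσ : |σ| = 1) :
    Tendsto (fun n : ℕ => E.expect (fun ω => σ * clipAt ((n : ℝ) + 1) (ω 0))) atTop
      (𝓝 (E.expect (fun ω => σ * ω 0))) := by
  obtain ⟨R, hR0, hR⟩ := hLp.exists_moment_le hγ.le le_rfl
  have hbound : ∀ n : ℕ, |E.expect (fun ω => σ * clipAt ((n : ℝ) + 1) (ω 0)) -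
      E.expect (fun ω => σ * ω 0)| ≤ ((n : ℝ) + 1) ^ (1 - γ) * R := by
    intro n
    have hL : (0 : ℝ) < (n : ℝ) + 1 := by positivity
    have hclip := isBddLip_clipAt hL.le
    obtain ⟨Y, hY⟩ := ((CylBddLip.const (n := 1) σ).mul (.coord hclip one_pos)).exists_bcf
    rw [← hY]
    refine abs_expect_sub_expect_le Y fun P hP => ?_
    obtain ⟨h1, h2, h3⟩ := hR P hP
    rw [hY, ← integral_sub (by rw [← hY]; exact Y.integrable _) (h1.const_mul σ)]
    refine (abs_integral_le_integral_abs).trans ?_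
    calc ∫ ω, |σ * clipAt ((n : ℝ) + 1) (ω 0) - σ * ω 0| ∂(P : Measure (ℕ → ℝ))
        ≤ ∫ ω, ((n : ℝ) + 1) ^ (1 - γ) * |ω 0| ^ γ ∂(P : Measure (ℕ → ℝ)) := by
          refine integral_mono_of_nonneg (ae_of_all _ fun ω => abs_nonneg _) (h2.const_mul _)
            (ae_of_all _ fun ω => ?_)
          dsimp only
          rw [← mul_sub, abs_mul, hσ, one_mul, abs_sub_comm]
          exact abs_sub_clipAt_le hL hγ.le _
      _ ≤ ((n : ℝ) + 1) ^ (1 - γ) * R := by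
          rw [integral_const_mul]
          gcongr
  rw [tendsto_iff_dist_tendsto_zero]
  refine squeeze_zero (fun _ => dist_nonneg) hbound ?_
  have h1 : Tendsto (fun n : ℕ => (n : ℝ) + 1) atTop atTop :=
    tendsto_atTop_add_const_right _ _ tendsto_natCast_atTop_atTop
  have h2 := (tendsto_rpow_neg_atTop (y := γ - 1) (by linarith)).comp h1
  simpa [Function.comp_def] using h2.mul_const R

/-- Truncated second moments, normalized, are summable uniformly over the maximal set. -/
theorem IsRepresentedBy.exists_summable_truncated_moment (h : E.IsRepresentedBy Θ₀)
    (hiid : E.IsIID (fun k ω => ω k)) {γ : ℝ} (hγ : 1 < γ) (hLp : E.MemLp γ (fun ω => ω 0)) :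
    ∃ v : ℕ → ℝ, Summable v ∧ ∀ P ∈ E.maximalSet, ∀ n : ℕ,
      ∫ ω, clipAt ((n : ℝ) + 1) (ω n) ^ 2 ∂(P : Measure (ℕ → ℝ)) ≤ v n * ((n : ℝ) + 1) ^ 2 := by
  obtain ⟨P₀, hP₀⟩ := h.nonempty
  have : Nonempty E.maximalSet := ⟨⟨P₀, h.subset_maximalSet hP₀⟩⟩
  -- `r ≤ 2` is needed to bound the truncated square, `r ≤ γ` for the moment to be finite, and `r >
  -- 1` for `(n + 1) ^ (-r)` to be summable.
  set r := min γ 2 with hr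
  have hr1 : 1 < r := lt_min hγ one_lt_two
  obtain ⟨R, hR0, hR⟩ := hLp.exists_moment_le hr1.le (min_le_left _ _)
  refine ⟨fun n => ((n : ℝ) + 1) ^ (-r) * R, ?_, fun P hP n => ?_⟩
  · have h1 : Summable (fun n : ℕ => ((n : ℝ)) ^ (-r)) := Real.summable_nat_rpow.2 (by linarith)
    have h2 := (summable_nat_add_iff 1).2 h1
    push_cast at h2
    exact h2.mul_right R
  · have hL : (0 : ℝ) < (n : ℝ) + 1 := by positivity
    have hclip := isBddLip_clipAt hL.le
    have hsq : IsBddLip (fun x => clipAt ((n : ℝ) + 1) x ^ 2) := by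
      simpa only [pow_two] using hclip.mul hclip
    obtain ⟨Y, hY⟩ := (CylBddLip.coord hsq n.lt_succ_self).exists_bcf
    have h1 := integral_le_expect hP Y
    rw [hY, expect_coord_eq hiid hsq n] at h1
    refine h1.trans (ciSup_le fun Q => ?_)
    obtain ⟨_, h2, h3⟩ := hR Q Q.2
    calc _ ≤ ∫ ω, ((n : ℝ) + 1) ^ (2 - r) * |ω 0| ^ r
          ∂((Q : ProbabilityMeasure (ℕ → ℝ)) : Measure (ℕ → ℝ)) :=
          integral_mono_of_nonneg (ae_of_all _ fun ω => sq_nonneg _) (h2.const_mul _)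
            (ae_of_all _ fun ω => clipAt_sq_le hL (by linarith) (min_le_right _ _) _)
      _ ≤ ((n : ℝ) + 1) ^ (2 - r) * R := by rw [integral_const_mul]; gcongr
      _ = ((n : ℝ) + 1) ^ (-r) * R * ((n : ℝ) + 1) ^ 2 := by
          rw [sub_eq_neg_add, Real.rpow_add hL, Real.rpow_two]; ring

/-- Truncation acts only where the square of the truncated coordinate reaches `(n + 1) ^ 2`.
Markov's inequality bounds that probability by `v n`, and Borel–Cantelli applies. -/
theorem ae_eventually_clipAt_eq {P : Measure (ℕ → ℝ)} [IsProbabilityMeasure P] {v : ℕ → ℝ}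
    (hv : Summable v)
    (hle : ∀ n : ℕ, ∫ ω, clipAt ((n : ℝ) + 1) (ω n) ^ 2 ∂P ≤ v n * ((n : ℝ) + 1) ^ 2) :
    ∀ᵐ ω ∂P, ∀ᶠ n : ℕ in atTop, clipAt ((n : ℝ) + 1) (ω n) = ω n := by
  have hmeas : ∀ n : ℕ, P {ω | ((n : ℝ) + 1) ^ 2 ≤ clipAt ((n : ℝ) + 1) (ω n) ^ 2} ≤
      ENNReal.ofReal (v n) := by
    intro n
    have hL : (0 : ℝ) < (n : ℝ) + 1 := by positivity
    have hclip := isBddLip_clipAt hL.le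
    have hsq : IsBddLip (fun x => clipAt ((n : ℝ) + 1) x ^ 2) := by
      simpa only [pow_two] using hclip.mul hclip
    obtain ⟨Y, hY⟩ := (CylBddLip.coord hsq n.lt_succ_self).exists_bcf
    have h1 := mul_meas_ge_le_integral_of_nonneg (μ := P)
      (f := fun ω => clipAt ((n : ℝ) + 1) (ω n) ^ 2) (ae_of_all _ fun ω => sq_nonneg _)
      (by rw [← hY]; exact Y.integrable _) (((n : ℝ) + 1) ^ 2)
    have h2 := h1.trans (hle n)
    rw [mul_comm] at h2
    have h3 := le_of_mul_le_mul_right h2 (by positivity)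
    rw [← ENNReal.ofReal_toReal (measure_ne_top P _)]
    exact ENNReal.ofReal_le_ofReal h3
  have hsum : ∑' n : ℕ, P {ω | ((n : ℝ) + 1) ^ 2 ≤ clipAt ((n : ℝ) + 1) (ω n) ^ 2} ≠ ⊤ :=
    ne_top_of_le_ne_top hv.tsum_ofReal_ne_top (ENNReal.tsum_le_tsum hmeas)
  filter_upwards [ae_eventually_notMem hsum] with ω hω
  filter_upwards [hω] with n hn
  have hL : (0 : ℝ) < (n : ℝ) + 1 := by positivity
  refine clipAt_of_abs_le (le_of_not_gt fun hgt => hn ?_)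
  show ((n : ℝ) + 1) ^ 2 ≤ clipAt ((n : ℝ) + 1) (ω n) ^ 2
  rw [← sq_abs (clipAt _ _), abs_clipAt hL.le, min_eq_right hgt.le]

/-- The truncated coordinates, centred by their conditional means, have vanishing averages. -/
theorem ae_tendsto_average_clipAt_sub_condExp {P : Measure (ℕ → ℝ)} [IsProbabilityMeasure P]
    {v a b : ℕ → ℝ} {α β : ℝ} (hv : Summable v)
    (hle : ∀ n : ℕ, ∫ ω, clipAt ((n : ℝ) + 1) (ω n) ^ 2 ∂P ≤ v n * ((n : ℝ) + 1) ^ 2)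
    (ha : Tendsto a atTop (𝓝 α)) (hb : Tendsto b atTop (𝓝 β))
    (hac : ∀ n : ℕ, ∀ᵐ ω ∂P,
      a n ≤ (P[fun ω => clipAt ((n : ℝ) + 1) (ω n)|coordFiltration n]) ω)
    (hcb : ∀ n : ℕ, ∀ᵐ ω ∂P,
      (P[fun ω => clipAt ((n : ℝ) + 1) (ω n)|coordFiltration n]) ω ≤ b n) :
    ∀ᵐ ω ∂P, Tendsto (fun N : ℕ => (N : ℝ)⁻¹ * ∑ n ∈ Finset.range N,
      (clipAt ((n : ℝ) + 1) (ω n) -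
        (P[fun ω => clipAt ((n : ℝ) + 1) (ω n)|coordFiltration n]) ω)) atTop (𝓝 0) := by
  set X : ℕ → (ℕ → ℝ) → ℝ := fun n ω => clipAt ((n : ℝ) + 1) (ω n) with hX
  set c : ℕ → (ℕ → ℝ) → ℝ := fun n => P[X n|coordFiltration n] with hc
  have hXcyl : ∀ n, CylBddLip (n + 1) (X n) := fun n =>
    .coord (isBddLip_clipAt (by positivity)) n.lt_succ_self
  have hXL2 : ∀ n, MeasureTheory.MemLp (X n) 2 P := fun n => by
    obtain ⟨Y, hY⟩ := (hXcyl n).exists_bcf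
    rw [← hY]
    exact MeasureTheory.MemLp.of_bound Y.continuous.aestronglyMeasurable ‖Y‖
      (ae_of_all _ fun ω => Y.norm_coe_le_norm ω)
  have hXint : ∀ n, Integrable (X n) P := fun n => (hXL2 n).integrable (by norm_num)
  have hcsq : ∀ n, ∀ᵐ ω ∂P, c n ω ^ 2 ≤ a n ^ 2 + b n ^ 2 := fun n => by
    filter_upwards [hac n, hcb n] with ω h1 h2
    rcases le_total 0 (c n ω) with h0 | h0
    · nlinarith [sq_nonneg (a n)]
    · nlinarith [sq_nonneg (b n)]
  obtain ⟨B, hB⟩ := ((ha.pow 2).add (hb.pow 2)).bddAbove_range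
  have hB' : ∀ n, a n ^ 2 + b n ^ 2 ≤ B := fun n => hB ⟨n, rfl⟩
  have hB0 : 0 ≤ B := le_trans (by positivity) (hB' 0)
  have hcL2 : ∀ n, MeasureTheory.MemLp (c n) 2 P := fun n =>
    MeasureTheory.MemLp.of_bound integrable_condExp.1 (B + 1) (by
      filter_upwards [hcsq n] with ω h1
      rw [Real.norm_eq_abs]
      have h2 := h1.trans (hB' n)
      nlinarith [sq_abs (c n ω), sq_nonneg (|c n ω| - 1)])
  refine ae_tendsto_average_zero_of_condExp_eq_zero (ℱ := coordFiltration)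
    -- From `(X - c) ^ 2 ≤ 2 * X ^ 2 + 2 * c ^ 2`, with `c ^ 2 ≤ B` because `c n` lies between the
    -- bounded sequences `a` and `b`.
    (e := fun n => X n - c n) (v := fun n => 2 * v n + 2 * B * (((n : ℝ) + 1) ^ 2)⁻¹)
    (fun n => ?_) (fun n => (hXL2 n).sub (hcL2 n)) (fun n => ?_) ?_ fun n => ?_
  · exact (hXcyl n).stronglyMeasurable.sub
      (stronglyMeasurable_condExp.mono (coordFiltration.mono n.le_succ))
  · filter_upwards [condExp_sub (hXint n) (integrable_condExp (f := X n) (m := coordFiltration n))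
      (coordFiltration n)] with ω h1
    rw [h1, Pi.sub_apply, condExp_of_stronglyMeasurable (coordFiltration.le n)
      stronglyMeasurable_condExp integrable_condExp]
    simp
  · refine (hv.mul_left 2).add (Summable.mul_left _ ?_)
    have := (summable_nat_add_iff 1).2 (Real.summable_nat_pow_inv.2 one_lt_two)
    push_cast at this
    exact this
  · have h1 : ∫ ω, (X n - c n) ω ^ 2 ∂P ≤ ∫ ω, (2 * X n ω ^ 2 + 2 * B) ∂P := by
      refine integral_mono_ae ((hXL2 n).sub (hcL2 n)).integrable_sq
        (((hXL2 n).integrable_sq.const_mul 2).add (integrable_const _)) ?_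
      filter_upwards [hcsq n] with ω h1
      have h2 := h1.trans (hB' n)
      simp only [Pi.sub_apply]
      nlinarith [sq_nonneg (X n ω + c n ω)]
    refine h1.trans ?_
    rw [integral_add ((hXL2 n).integrable_sq.const_mul 2) (integrable_const _), integral_const_mul]
    have h3 : (2 * v n + 2 * B * (((n : ℝ) + 1) ^ 2)⁻¹) * ((n : ℝ) + 1) ^ 2 =
        2 * (v n * ((n : ℝ) + 1) ^ 2) + 2 * B := by
      have : (n : ℝ) + 1 ≠ 0 := by positivity
      field_simp
    rw [h3]
    have := hle n
    simp only [integral_const, probReal_univ, one_smul]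
    linarith

end SublinearExpectation

/-! ### Construction of the steered measure -/

theorem CylBddLip.sum {n : ℕ} {ι : Type*} (t : Finset ι) {X : ι → (ℕ → ℝ) → ℝ}
    (hX : ∀ i ∈ t, CylBddLip n (X i)) : CylBddLip n (fun ω => ∑ i ∈ t, X i ω) := by
  classical
  induction t using Finset.induction_on with
  | empty => simpa using CylBddLip.const (n := n) 0
  | insert i t hi ih =>
    simp only [Finset.sum_insert hi]
    exact (hX i (Finset.mem_insert_self i t)).add
      (ih fun j hj => hX j (Finset.mem_insert_of_mem hj))

/-- The bounded continuous functions that are Lipschitz functions of the first `d` coordinates. -/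
def cylSubmodule (d : ℕ) : Submodule ℝ (BoundedContinuousFunction (ℕ → ℝ) ℝ) where
  carrier := {f | CylBddLip d f}
  add_mem' hf hg := CylBddLip.add hf hg
  zero_mem' := CylBddLip.const 0
  smul_mem' c _ hf := (CylBddLip.const c).mul hf

/-- The steering factor: a truncation of the distance of the partial sum to its target. -/
noncomputable def steering {d : ℕ} (p : ℕ → (Fin d → ℝ) → ℝ) (n : ℕ) (ω : ℕ → ℝ) : ℝ :=
  clipAt 1 (n * p n (fun i => ω i) - ∑ k ∈ Finset.range n, ω k)

theorem clipAt_one_pos {x : ℝ} (h : 0 < x) : 0 < clipAt 1 x :=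
  lt_max_of_lt_right (lt_min h one_pos)

theorem clipAt_one_neg {x : ℝ} (h : x < 0) : clipAt 1 x < 0 :=
  max_lt (by norm_num) (min_lt_of_left_lt h)

/-- The partial sum stops before coordinate `n`, so the factor is predictable once `d ≤ n`; clipping
restores the boundedness that the sum lacks. -/
theorem cylBddLip_steering {d : ℕ} {p : ℕ → (Fin d → ℝ) → ℝ} (hp : ∀ n, IsBddLip (p n)) {n : ℕ}
    (hn : d ≤ n) : CylBddLip n (steering p n) := by
  obtain ⟨f, hf, hfp⟩ := (CylBddLip.mono (X := fun ω => (n : ℝ) * p n (fun i => ω i))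
    ⟨_, (IsBddLip.const (n : ℝ)).mul (hp n), rfl⟩ hn)
  obtain ⟨L, hsum⟩ : ∃ L, LipschitzWith L (fun x : Fin n → ℝ => ∑ i, x i) := by
    have := (∑ i : Fin n, ContinuousLinearMap.proj (R := ℝ) (φ := fun _ : Fin n => ℝ) i).lipschitz
    refine ⟨_, by convert! this using 1; ext x; simp⟩
  refine ⟨fun x => clipAt 1 (f x - ∑ i, x i),
    (isBddLip_clipAt zero_le_one).comp (hf.2.choose_spec.sub hsum), ?_⟩
  funext ω
  rw [steering, congrFun hfp ω, Finset.sum_range]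

namespace SublinearExpectation

variable {E : SublinearExpectation (ℕ → ℝ)} {Θ₀ : Set (ProbabilityMeasure (ℕ → ℝ))}

/-- A representing compact set contains a measure under which, from time `d` on, the conditional
means of the truncated coordinates are extremal as prescribed by the sign of the steering factor,
the targets being approximations of `f`. -/
theorem IsRepresentedBy.exists_steered (h : E.IsRepresentedBy Θ₀) (hc : IsCompact Θ₀)
    (hiid : E.IsIID (fun k ω => ω k)) {d : ℕ} {f : (Fin d → ℝ) → ℝ} (hf : Measurable f) {C : ℝ}
    (hC : ∀ x, |f x| ≤ C) {χ : ℕ → ℝ → ℝ} (hχ : ∀ n, IsBddLip (χ n)) :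
    ∃ (p : ℕ → (Fin d → ℝ) → ℝ) (_ : ∀ n, IsBddLip (p n)), ∃ P ∈ Θ₀,
      (∀ᵐ ω ∂(P : Measure (ℕ → ℝ)),
        Tendsto (fun n => p n (fun i => ω i)) atTop (𝓝 (f fun i => ω i))) ∧
      ∀ n, d ≤ n →
        0 ≤ ∫ ω, E.centered (steering p n) (χ n) n ω ∂(P : Measure (ℕ → ℝ)) := by
  -- Fixing the face first gives all its measures the same law `Q` of the first `d` coordinates, so
  -- `p` can be chosen from `Q` before the measure is selected.
  obtain ⟨K, hKΘ, hKc, ⟨P₀, hP₀⟩, hconst, hK⟩ := h.exists_face hc (cylSubmodule d)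
  have hym : Measurable (fun (ω : ℕ → ℝ) (i : Fin d) => ω i) := by fun_prop
  set Q : Measure (Fin d → ℝ) := (P₀ : Measure (ℕ → ℝ)).map (fun ω i => ω i) with hQ
  have hQp : IsProbabilityMeasure Q := Measure.isProbabilityMeasure_map hym.aemeasurable
  have hlaw : ∀ P ∈ K, (P : Measure (ℕ → ℝ)).map (fun ω (i : Fin d) => ω i) = Q := by
    intro P hP
    have := Measure.isProbabilityMeasure_map (μ := (P : Measure (ℕ → ℝ))) hym.aemeasurable
    refine Measure.ext_of_forall_integral_isBddLip fun g hg => ?_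
    have hgcyl : CylBddLip d (fun ω => g fun i => ω i) := ⟨g, hg, rfl⟩
    obtain ⟨G, hG⟩ := hgcyl.exists_bcf
    have hGm : G ∈ cylSubmodule d := by
      show CylBddLip d G
      rwa [hG]
    rw [hQ, integral_map hym.aemeasurable hg.continuous.aestronglyMeasurable,
      integral_map hym.aemeasurable hg.continuous.aestronglyMeasurable]
    simpa only [hG] using hconst G hGm P hP P₀ hP₀
  obtain ⟨p, hp, hpf⟩ := exists_isBddLip_tendsto_ae Q
    (MeasureTheory.MemLp.of_bound hf.aestronglyMeasurable C (ae_of_all _ hC))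
  have hterm : ∀ k, CylBddLip (d + k + 1) (E.centered (steering p (d + k)) (χ (d + k)) (d + k)) :=
    fun k => cylBddLip_centered (cylBddLip_steering hp (Nat.le_add_right _ _)) (hχ _)
  set Z : ℕ → (ℕ → ℝ) → ℝ := fun N ω =>
    ∑ k ∈ Finset.range N, E.centered (steering p (d + k)) (χ (d + k)) (d + k) ω with hZ
  have hZcyl : ∀ N, CylBddLip (d + N) (Z N) := fun N => CylBddLip.sum _ fun k hk =>
    (hterm k).mono (by have := Finset.mem_range.1 hk; omega)
  choose Y hY using fun N => (hZcyl N).exists_bcf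
  choose W hW using fun k => (hterm k).exists_bcf
  have hYs : ∀ N, Y (N + 1) = Y N + W N := by
    intro N
    ext ω
    rw [BoundedContinuousFunction.coe_add, Pi.add_apply, hY, hY, hW]
    exact Finset.sum_range_succ _ _
  -- The last term is removed first: the test function and all earlier terms depend only on its past
  -- and play the role of `H`.
  have hexp : ∀ g : BoundedContinuousFunction (ℕ → ℝ) ℝ, CylBddLip d g → ∀ N,
      E (g + Y N) = E g := by
    intro g hg N
    induction N with
    | zero =>
      have h0 : Y 0 = 0 := by ext ω; rw [hY]; simp [hZ]
      rw [h0, add_zero]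
    | succ N ih =>
      rw [← ih, ← h.expect_eq, ← h.expect_eq, hYs, ← add_assoc,
        ← h.expect_add_centered hiid (H := ⇑(g + Y N)) (s := steering p (d + N))
          (χ := χ (d + N)) (n := d + N) ?_ (cylBddLip_steering hp (Nat.le_add_right _ _)) (hχ _),
        ← hW]
      · rfl
      · rw [BoundedContinuousFunction.coe_add, hY]
        exact (hg.mono (Nat.le_add_right _ _)).add (hZcyl N)
  have hWle : ∀ P ∈ K, ∀ k, ∫ ω, W k ω ∂(P : Measure (ℕ → ℝ)) ≤ 0 := by
    intro P hP k
    rw [hW]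
    exact h.integral_centered_nonpos hiid (h.subset_maximalSet (hKΘ hP))
      (cylBddLip_steering hp (Nat.le_add_right _ _)) (hχ _)
  have hYint : ∀ (P : ProbabilityMeasure (ℕ → ℝ)) N, ∫ ω, Y (N + 1) ω ∂(P : Measure (ℕ → ℝ)) =
      ∫ ω, Y N ω ∂(P : Measure (ℕ → ℝ)) + ∫ ω, W N ω ∂(P : Measure (ℕ → ℝ)) := by
    intro P N
    rw [hYs, ← integral_add ((Y N).integrable _) ((W N).integrable _)]
    rfl
  have hYle : ∀ P ∈ K, ∀ N, ∫ ω, Y N ω ∂(P : Measure (ℕ → ℝ)) ≤ 0 := by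
    intro P hP N
    induction N with
    | zero => rw [hY]; simp [hZ]
    | succ N ih => rw [hYint]; linarith [hWle P hP N]
  have hcl : ∀ N, IsClosed {P : ProbabilityMeasure (ℕ → ℝ) |
      0 ≤ ∫ ω, Y N ω ∂(P : Measure (ℕ → ℝ))} := fun N => isClosed_le continuous_const
    (ProbabilityMeasure.continuous_integral_boundedContinuousFunction (Y N))
  -- The sets are nested because each added term has nonpositive integral. A measure in all of them
  -- makes every term integrate to zero.
  obtain ⟨P, hP⟩ := IsCompact.nonempty_iInter_of_sequence_nonempty_isCompact_isClosed
    (fun N => K ∩ {P : ProbabilityMeasure (ℕ → ℝ) | 0 ≤ ∫ ω, Y N ω ∂(P : Measure (ℕ → ℝ))})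
    (fun N P hP => ⟨hP.1, by
      have h1 : 0 ≤ ∫ ω, Y (N + 1) ω ∂(P : Measure (ℕ → ℝ)) := hP.2
      rw [hYint] at h1
      show 0 ≤ ∫ ω, Y N ω ∂(P : Measure (ℕ → ℝ))
      linarith [hWle P hP.1 N]⟩)
    (fun N => hK (Y N) fun g hg => (hexp g hg N).ge)
    (hKc.inter_right (hcl 0)) (fun N => hKc.isClosed.inter (hcl N))
  rw [Set.mem_iInter] at hP
  have hPK : P ∈ K := (hP 0).1
  refine ⟨p, hp, P, hKΘ hPK, ?_, fun n hn => ?_⟩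
  · have hae := hpf
    rw [← hlaw P hPK] at hae
    exact ae_of_ae_map hym.aemeasurable hae
  · obtain ⟨k, rfl⟩ := Nat.exists_eq_add_of_le hn
    have h1 : 0 ≤ ∫ ω, Y (k + 1) ω ∂(P : Measure (ℕ → ℝ)) := (hP (k + 1)).2
    rw [hYint] at h1
    rw [← hW]
    linarith [hYle P hPK k]

end SublinearExpectation

/-! ### Conclusion -/

/-- On `Ω = ℝ^ℕ` with coordinate process `ξ_{k+1}(ω) = ω k`, `k = 0, 1, …`. -/
theorem mainTheorem6 (E : SublinearExpectation (ℕ → ℝ)) (hreg : E.IsRegular)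
    (γ : ℝ) (hγ : 1 < γ) (hLp : ∀ k : ℕ, E.MemLp γ (fun ω => ω k))
    (hiid : E.IsIID (fun k ω => ω k))
    (Θ₀ : Set (ProbabilityMeasure (ℕ → ℝ))) (hcompact : IsCompact Θ₀)
    (hrep : E.IsRepresentedBy Θ₀)
    (d : ℕ) (π : (Fin d → ℝ) → ℝ) (hπ : Measurable π)
    (hval : ∀ x, π x ∈ Set.Icc (-E.expect (fun ω => -ω 0)) (E.expect (fun ω => ω 0))) :
    ∃ P ∈ Θ₀, ∀ᵐ ω ∂(P : Measure (ℕ → ℝ)),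
      Tendsto (fun n : ℕ => (∑ k ∈ Finset.range n, ω k) / (n : ℝ)) atTop
        (𝓝 (π (fun i : Fin d => ω i))) := by
  obtain ⟨P₀, hP₀⟩ := hrep.nonempty
  have : Nonempty E.maximalSet := ⟨⟨P₀, hrep.subset_maximalSet hP₀⟩⟩
  have hχ : ∀ n : ℕ, IsBddLip (clipAt ((n : ℝ) + 1)) := fun n => isBddLip_clipAt (by positivity)
  obtain ⟨p, hp, P, hPΘ, hpπ, hsteer⟩ := hrep.exists_steered hcompact hiid hπ
    (fun x => abs_le_max_abs_abs (hval x).1 (hval x).2) hχ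
  have hPmax := hrep.subset_maximalSet hPΘ
  refine ⟨P, hPΘ, ?_⟩
  obtain ⟨v, hv, hle⟩ := hrep.exists_summable_truncated_moment hiid hγ (hLp 0)
  have hup : Tendsto (fun n : ℕ => E.expect (fun ω => clipAt ((n : ℝ) + 1) (ω n))) atTop
      (𝓝 (E.expect (fun ω => ω 0))) := by
    have := E.tendsto_expect_clipAt hγ (hLp 0) (σ := 1) (by simp)
    simp only [one_mul] at this
    exact this.congr fun n => (E.expect_coord_eq hiid (hχ n) n).symm
  have hlow : Tendsto (fun n : ℕ => - E.expect (fun ω => - clipAt ((n : ℝ) + 1) (ω n))) atTop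
      (𝓝 (- E.expect (fun ω => - ω 0))) := by
    have := E.tendsto_expect_clipAt hγ (hLp 0) (σ := -1) (by simp)
    simp only [neg_mul, one_mul] at this
    exact (this.congr fun n => (E.expect_coord_eq hiid (hχ n).neg n).symm).neg
  have hac := fun n : ℕ => hrep.le_condExp hiid hPmax (hχ n) n
  have hcb := fun n : ℕ => hrep.condExp_le hiid hPmax (hχ n) n
  have hnoise := SublinearExpectation.ae_tendsto_average_clipAt_sub_condExp hv (hle P hPmax)
    hlow hup hac hcb
  have hext : ∀ᵐ ω ∂(P : Measure (ℕ → ℝ)), ∀ n : ℕ, d ≤ n → _ :=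
    ae_all_iff.2 fun n => Filter.eventually_imp_distrib_left.2 fun hn =>
      hrep.condExp_eq_of_integral_centered_nonneg hiid hPmax (hχ n) (cylBddLip_steering hp hn)
        (hsteer n hn)
  filter_upwards [hpπ, hnoise, hext, ae_all_iff.2 hac, ae_all_iff.2 hcb,
    SublinearExpectation.ae_eventually_clipAt_eq hv (hle P hPmax)] with ω h1 h2 h3 h4 h5 h6
  -- From here the argument is pathwise. The noise refers to the truncated coordinates, which `h6`
  -- eventually identifies with the true ones; the unsteered times before `d` are finitely many.
  refine tendsto_average_of_drift h2 (h6.mono fun n hn => ?_) hlow hup h1 (hval _).1 (hval _).2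
    h4 h5 ?_ ?_
  · rw [hn]; ring
  · filter_upwards [eventually_ge_atTop d] with n hn hlt
    exact (h3 n hn).1 (clipAt_one_pos (sub_pos.2 hlt))
  · filter_upwards [eventually_ge_atTop d] with n hn hlt
    exact (h3 n hn).2 (clipAt_one_neg (sub_neg.2 hlt))
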